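/- **Setting.** Let $\mathbf{R}[[t^{\mathbf{R}}]]\subset\mathbf{C}[[t^{\mathbf{R}}]]$ be the fields of Hahn series with well-ordered support in $\mathbf{R}$. For nonzero $\alpha\in\mathbf{R}[[t^{\mathbf{R}}]]$ with leading term $ct^{\gamma}$ put $v_{\mathbf{R}}(\alpha)=(\operatorname{sign}c,\gamma)$, and put $v_{\mathbf{R}}(0)=\infty$. The signed tropical hyperfield is $\mathbf{TR}=(\{\pm1\}\times\mathbf{R})\cup\{\infty\}$ with product $(s,r)(s',r')=(ss',r+r')$ ($\infty$ is absorbing, the unit is $(1,0)$) and hyperaddition $\infty\boxplus a=a\boxplus\infty=\{a\}$ and, for $(s,r)$ and $(s',r')$: $(s,r)\boxplus(s',r')=\{(s,r)\}$ if $r<r'$, or if $r=r'$ and $s=s'$; $=\{(s',r')\}$ if $r'<r$; and $=\{(\pm1,u):u\ge r\}\cup\{\infty\}$ if $r=r'$ and $s=-s'$. Here $\infty$ is the zero of the hyperfield, $-(s,r)=(-s,r)$, $-\infty=\infty$ and $|(s,r)|=r$. For a polynomial $p=\sum_i c_ix^i$ over $\mathbf{TR}$ (a finitely supported sequence of coefficients)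 write $p\in(x-a)q$, with $q=\sum_i d_ix^i$, if $c_0=-ad_0$ and $c_i\in(-ad_i)\boxplus d_{i-1}$ for all $i\ge1$. The multiplicity $\operatorname{mult}_a(p)$ is defined recursively: it is $0$ if $\infty\notin\boxplus_i c_ia^i$, and $1+\max\{\operatorname{mult}_a(q):p\in(x-a)q\}$ otherwise. Write $p(-x)=\sum_i(-1,0)^ic_ix^i$. The Newton polygon $\operatorname{Newt}(P)$ of $P=\sum_i C_ix^i\in\mathbf{R}[[t^{\mathbf{R}}]][x]$ is the lower convex hull of the points $(i,\operatorname{ord}C_i)$ with $C_i\ne0$, where $\operatorname{ord}C_i$ is the exponent of the leading term; an edge is a bounded edge. **Theorem.** For every $p=\sum_i c_ix^i\in\mathbf{TR}[x]$ there is a polynomial $P=\sum_i C_ix^i\in\mathbf{R}[[t^{\mathbf{R}}]][x]$ such that $v_{\mathbf{R}}(C_i)=c_i$ for all $i$ and, for every edge of $\operatorname{Newt}(P)$, writing its slope as $-r$ and putting $a=(+1,r)$: among the roots of $P$ in $\mathbf{C}[[t^{\mathbf{R}}]]$, counted with multiplicity, exactly $\operatorname{mult}_a(p)$ have valuation $r$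 and a leading coefficient that is real and positive, and exactly $\operatorname{mult}_{-a}(p)=\operatorname{mult}_{a}(p(-x))$ have valuation $r$ and a leading coefficient that is real and negative. -/

import Mathlib

noncomputable section

/-! ### The signed tropical hyperfield -/

/-- The underlying multiplicative structure of the signed tropical hyperfield
`TR = ({±1} × ℝ) ∪ {∞}`. The product is `(s, r) · (s', r') = (s s', r + r')`; the element `∞`,
which is absorbing for the product and neutral for the hyperaddition, is the `0` of this type, and
the unit `1` is `(+1, 0)`. -/
abbrev TR : Type := WithZero (ℤˣ × Multiplicative ℝ)

namespace TR

/-- The element `(s, r)` of `TR`. -/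
def of (s : ℤˣ) (r : ℝ) : TR := ((s, Multiplicative.ofAdd r) : ℤˣ × Multiplicative ℝ)

/-- The valuation `|(s, r)| = r`, `|∞| = ∞`. -/
def val (a : TR) : WithTop ℝ :=
  WithZero.recZeroCoe (motive := fun _ => WithTop ℝ) ⊤
    (fun x => ((Multiplicative.toAdd x.2 : ℝ) : WithTop ℝ)) a

/-- The hyperadditive inverse `-(s, r) = (-s, r)`, `-∞ = ∞`. -/
def neg (a : TR) : TR := of (-1) 0 * a

/-- Hyperaddition of two elements `(s, r)` and `(s', r')` different from `∞`. -/
def haddCoe (x y : ℤˣ × Multiplicative ℝ) : Set TR :=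
  if Multiplicative.toAdd x.2 < Multiplicative.toAdd y.2 then {(x : TR)}
  else if Multiplicative.toAdd y.2 < Multiplicative.toAdd x.2 then {(y : TR)}
  else if x.1 = y.1 then {(x : TR)}
  else {z : TR | val (x : TR) ≤ val z}

/-- Hyperaddition in `TR`. -/
def hadd (a b : TR) : Set TR :=
  WithZero.recZeroCoe (motive := fun _ => Set TR) {b}
    (fun x : ℤˣ × Multiplicative ℝ => WithZero.recZeroCoe (motive := fun _ => Set TR) {a}
      (fun y : ℤˣ × Multiplicative ℝ => haddCoe x y) b) a

/-- The hypersum `f 0 ⊞ f 1 ⊞ ⋯ ⊞ f (n - 1)`, bracketed from the left (the empty sum is `{∞}`). -/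
def hsum (f : ℕ → TR) : ℕ → Set TR
  | 0 => {0}
  | n + 1 => ⋃ b ∈ hsum f n, hadd b (f n)

end TR

/-- Polynomials over the signed tropical hyperfield, as finitely supported sequences of
coefficients (a coefficient `∞` is a missing monomial). -/
abbrev TRPoly : Type := ℕ →₀ TR

namespace TRPoly

/-- The degree (`0` for the zero polynomial). -/
def natDegree (p : TRPoly) : ℕ := p.support.sup id

/-- The set `p(a) = ⊞ᵢ cᵢ aⁱ`. -/
def evalSet (p : TRPoly) (a : TR) : Set TR :=
  TR.hsum (fun i => p i * a ^ i) (p.natDegree + 1)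

/-- The relation `p ∈ (x - a) q` for `p = ∑ cᵢ xⁱ` and `q = ∑ dᵢ xⁱ`, that is `c₀ = -a d₀` and
`cᵢ ∈ (-a dᵢ) ⊞ dᵢ₋₁` for `i ≥ 1`. -/
def MemLinMul (p : TRPoly) (a : TR) (q : TRPoly) : Prop :=
  p 0 = TR.neg (a * q 0) ∧
    ∀ i : ℕ, p (i + 1) ∈ TR.hadd (TR.neg (a * q (i + 1))) (q i)

open Classical in
/-- The recursion for the multiplicity, unfolded at most `n` times. -/
def multAux (a : TR) : ℕ → TRPoly → ℕ∞
  | 0, _ => 0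
  | n + 1, p =>
    if (0 : TR) ∈ p.evalSet a then 1 + ⨆ (q : TRPoly) (_ : p.MemLinMul a q), multAux a n q else 0

/-- The multiplicity `mult_a(p)` of `a` as a root of `p`: it is `0` if `∞ ∉ p(a)`, and
`1 + max {mult_a(q) : p ∈ (x - a) q}` if `∞ ∈ p(a)`; see `mult_eq`. -/
def mult (a : TR) (p : TRPoly) : ℕ∞ := ⨆ n : ℕ, multAux a n p

open Classical in
/-- The recursive characterization of the multiplicity. -/
theorem mult_eq (a : TR) (p : TRPoly) :
    mult a p =
      if (0 : TR) ∈ p.evalSet a then 1 + ⨆ (q : TRPoly) (_ : p.MemLinMul a q), mult a q else 0 := by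
  have h : mult a p = ⨆ n : ℕ, multAux a (n + 1) p := by
    apply le_antisymm
    · refine iSup_le fun n => ?_
      cases n with
      | zero => simp [multAux]
      | succ n => exact le_iSup (fun n : ℕ => multAux a (n + 1) p) n
    · exact iSup_le fun n => le_iSup (fun n : ℕ => multAux a n p) (n + 1)
  rw [h]
  by_cases h0 : (0 : TR) ∈ p.evalSet a
  · simp only [multAux, h0, if_true, mult]
    rw [← ENat.add_iSup]
    congr 1
    rw [iSup_comm]
    exact iSup_congr fun q => iSup_comm
  · simp [multAux, h0]

/-- The polynomial `p(-x)`. -/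
def compNeg (p : TRPoly) : TRPoly :=
  Finsupp.ofSupportFinite (fun i => TR.of (-1) 0 ^ i * p i)
    (p.hasFiniteSupport.subset fun _ hi => right_ne_zero_of_mul hi)

end TRPoly

/-! ### Newton polygons -/

/-- The lower convex hull of a set of points of the plane: the convex hull together with everything
above it. -/
def lowerConvexHull (S : Set (ℝ × ℝ)) : Set (ℝ × ℝ) :=
  {z | ∃ y : ℝ, (z.1, y) ∈ convexHull ℝ S ∧ y ≤ z.2}

/-- `σ` is a bounded edge, of slope `m`, of the Newton polygon `N`: it is the face of `N` on which
`y - m x` is minimal, and this face is not reduced to a point. -/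
def IsNewtonEdge (N σ : Set (ℝ × ℝ)) (m : ℝ) : Prop :=
  σ = {z ∈ N | ∀ w ∈ N, z.2 - m * z.1 ≤ w.2 - m * w.1} ∧ σ.Nontrivial

/-! ### Hahn series -/

open Classical in
/-- The map `v_ℝ : ℝ[[t^ℝ]] → TR`, which sends a nonzero series with leading term `c t^γ` to
`(sign c, γ)` and `0` to `∞`. -/
def vR (α : HahnSeries ℝ ℝ) : TR :=
  if α = 0 then 0 else TR.of (if 0 < α.leadingCoeff then 1 else -1) α.order

/-- The Newton polygon of a polynomial over `ℝ[[t^ℝ]]`. -/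
def newt (P : Polynomial (HahnSeries ℝ ℝ)) : Set (ℝ × ℝ) :=
  lowerConvexHull {z | ∃ i : ℕ, P.coeff i ≠ 0 ∧ z = ((i : ℝ), (P.coeff i).order)}

/-- The inclusion `ℝ[[t^ℝ]] → ℂ[[t^ℝ]]`. -/
def hahnOfReal : HahnSeries ℝ ℝ →+* HahnSeries ℝ ℂ where
  toFun α := α.map Complex.ofRealHom
  map_zero' := by ext; simp
  map_one' := HahnSeries.map_one (Complex.ofRealHom : ℝ →+* ℂ).toMonoidWithZeroHom
  map_add' α β := HahnSeries.map_add Complex.ofRealHom.toAddMonoidHom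
  map_mul' α β := HahnSeries.map_mul Complex.ofRealHom.toNonUnitalRingHom

open Classical in
/-- The number of roots in `ℂ[[t^ℝ]]`, counted with multiplicity, of a polynomial over `ℝ[[t^ℝ]]`
that have valuation `r` and whose leading coefficient is a real number of sign `s`. -/
def rootCount (P : Polynomial (HahnSeries ℝ ℝ)) (r : ℝ) (s : ℤˣ) : ℕ :=
  Multiset.card ((P.map hahnOfReal).roots.filter fun β =>
    β.orderTop = (r : WithTop ℝ) ∧ ∃ c : ℝ, 0 < ((s : ℤ) : ℝ) * c ∧ β.leadingCoeff = (c : ℂ))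

end

/-!
The proof rests on Descartes' rule of signs in three settings. All of them compare a number of roots
with `HasAlternation`, the existence of a chain of `k` sign changes in a sequence of signs.

*Combinatorics.* If `b` is a possible sign sequence of `(x - 1) e`, then `b` has at least one sign
change more than `e` (`HasAlternation.succ_of_linMul`). For real polynomials this gives the classical
bound on the number of positive roots (`hasAlternation_of_prod_dvd`).

*The signed tropical hyperfield.* Replacing `x` by `a x` reduces a factor `x - a` to `x - 1`, and
only the signs of the terms of `p(a)` of least valuation `m` matter. The same combinatorial lemma
bounds the multiplicity from above. Conversely, a sequence with a sign change at its least valuation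
can be divided by `x - 1` losing only one sign change (`TR.exists_isLinMul`). Hence `mult_a(p)` is
the number of sign changes among the terms of `p(a)` of least valuation (`TRPoly.le_mult_iff`).

*Hahn series.* The polynomial `P` has the coefficients `± 4 ^ (-i ^ 2) t ^ γ` prescribed by `p`. For
a sign `s` and a real number `r`, the reduction of `t ^ (-m) P(s t ^ r x)` is a real polynomial with
coefficients `± 4 ^ (-i ^ 2)` on the terms of least valuation. Its `i`-th term dominates at
`x = 16 ^ i`, so by the intermediate value theorem it has as many positive roots as sign changes
(`exists_pos_roots_of_gaussWeight`); by Descartes' rule there are no more, and they are simple. This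
works for all slopes and for both signs with the same `P`. The simple roots lift to roots of `P` by
Hensel's lemma in the complete valuation ring of Hahn series (`exists_root_of_simple_root`), and
conversely the roots of `P` in question reduce to positive roots with multiplicity
(`real_prod_dvd_of_roots`), so their number is the number of sign changes
(`TRPoly.le_rootCount_iff`).

The edge enters only through the fact that a polynomial whose Newton polygon has an edge is not zero:
for a slope that is not the slope of an edge both sides are zero.
-/

/-! ### Alternating chains of signs -/

/-- A sequence of signs has an alternating chain with `k` changes: there are positions
`i₀ < ⋯ < iₖ` at which its values are nonzero and each is the negative of the one before. The
largest such `k` is the number of sign changes of the sequence; the function `g` enumerates the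
positions, and its values beyond `k` are irrelevant. -/
def HasAlternation (b : ℕ → SignType) (k : ℕ) : Prop :=
  ∃ g : ℕ → ℕ, (∀ j < k, g j < g (j + 1)) ∧ b (g 0) ≠ 0 ∧ ∀ j < k, b (g (j + 1)) = -b (g j)

theorem hasAlternation_zero_iff {b : ℕ → SignType} : HasAlternation b 0 ↔ ∃ i, b i ≠ 0 :=
  ⟨fun ⟨g, _, h, _⟩ => ⟨g 0, h⟩, fun ⟨i, h⟩ => ⟨fun _ => i, by simp, h, by simp⟩⟩

theorem HasAlternation.mono {b : ℕ → SignType} {k l : ℕ} (h : HasAlternation b k) (hl : l ≤ k) :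
    HasAlternation b l := by
  obtain ⟨g, h1, h2, h3⟩ := h
  exact ⟨g, fun j hj => h1 j (by omega), h2, fun j hj => h3 j (by omega)⟩

theorem SignType.neg_ne_zero {x : SignType} : -x ≠ 0 ↔ x ≠ 0 := by
  revert x
  decide

theorem SignType.ne_neg_self {x : SignType} (hx : x ≠ 0) : x ≠ -x := by
  revert hx
  revert x
  decide

theorem alternation_ne_zero {b : ℕ → SignType} {k : ℕ} {g : ℕ → ℕ} (h0 : b (g 0) ≠ 0)
    (h : ∀ j < k, b (g (j + 1)) = -b (g j)) {j : ℕ} (hj : j ≤ k) : b (g j) ≠ 0 := by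
  induction j with
  | zero => exact h0
  | succ j ih =>
    rw [h j (by omega)]
    exact SignType.neg_ne_zero.2 (ih (by omega))

theorem hasAlternation_mul_iff {b : ℕ → SignType} {ε : SignType} (hε : ε ≠ 0) {k : ℕ} :
    HasAlternation (fun i => b i * ε) k ↔ HasAlternation b k := by
  have h1 : ∀ x ε : SignType, ε ≠ 0 → (x * ε ≠ 0 ↔ x ≠ 0) := by decide
  have h2 : ∀ x y ε : SignType, ε ≠ 0 → (x * ε = -(y * ε) ↔ x = -y) := by decide
  simp only [HasAlternation, h1 _ _ hε, h2 _ _ _ hε]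

/-- The positions of a chain with `k` changes are at least `0, 1, …, k`. -/
theorem alternation_le {k : ℕ} {g : ℕ → ℕ} (h : ∀ j < k, g j < g (j + 1)) {j : ℕ} (hj : j ≤ k) :
    j ≤ g j := by
  induction j with
  | zero => simp
  | succ j ih =>
    have := ih (by omega)
    have := h j (by omega)
    omega

theorem HasAlternation.le_of_support {b : ℕ → SignType} {k N : ℕ} (h : HasAlternation b k)
    (hb : ∀ i, N < i → b i = 0) : k ≤ N := by
  obtain ⟨g, h1, h2, h3⟩ := h
  by_contra! hk
  exact alternation_ne_zero h2 h3 le_rfl (hb _ (hk.trans_le (alternation_le h1 le_rfl)))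

/-- The combinatorial core of Descartes' rule of signs. The hypotheses say that `b` is a possible
sign sequence for the product of `x - 1` with a polynomial of sign sequence `e`: whenever `e` changes
from one position to the next, the nonzero sign among `-eᵢ₊₁` and `eᵢ` determines `bᵢ₊₁`. Then `b`
takes the value `-ε` at the start of every block of `e` of sign `ε`, and the sign of the last block
just after its end, which is one sign change more than `e` has. -/
theorem HasAlternation.succ_of_linMul {b e : ℕ → SignType} {N k : ℕ} (h0 : b 0 = -e 0)
    (hA : ∀ i, e (i + 1) ≠ 0 → e i ≠ e (i + 1) → b (i + 1) = -e (i + 1))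
    (hB : ∀ i, e i ≠ 0 → e (i + 1) ≠ e i → b (i + 1) = e i)
    (hN : ∀ i, N ≤ i → e i = 0) (h : HasAlternation e k) : HasAlternation b (k + 1) := by
  classical
  obtain ⟨g, h1, h2, h3⟩ := h
  have hne : ∀ j ≤ k, e (g j) ≠ 0 := fun j hj => alternation_ne_zero h2 h3 hj
  have start : ∀ j, e j ≠ 0 → ∃ n ≤ j, b n = -e j := by
    intro j hj
    have hex : ∃ n, e n = e j := ⟨j, rfl⟩
    refine ⟨Nat.find hex, Nat.find_min' hex rfl, ?_⟩
    have hs := Nat.find_spec hex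
    rcases hn : Nat.find hex with _ | n
    · rw [hn] at hs; rw [h0, hs]
    · rw [hn] at hs
      have := Nat.find_min hex (m := n) (by omega)
      rw [hA n (by rw [hs]; exact hj) (by rw [hs]; exact this), hs]
  have between : ∀ i j, i < j → e j ≠ 0 → e i ≠ e j → ∃ n, i < n ∧ n ≤ j ∧ b n = -e j := by
    intro i j hij hj hne
    have hex : ∃ n, i < n ∧ e n = e j := ⟨j, hij, rfl⟩
    refine ⟨Nat.find hex, (Nat.find_spec hex).1, Nat.find_min' hex ⟨hij, rfl⟩, ?_⟩
    have hs := Nat.find_spec hex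
    rcases hn : Nat.find hex with _ | n
    · omega
    · rw [hn] at hs
      have hmin := Nat.find_min hex (m := n) (by omega)
      have : e n ≠ e j := by
        intro h
        rcases (Nat.lt_succ_iff_lt_or_eq.1 hs.1) with hlt | heq
        · exact hmin ⟨hlt, h⟩
        · exact hne (heq ▸ h)
      rw [hA n (by rw [hs.2]; exact hj) (by rw [hs.2]; exact this), hs.2]
  have finish : ∀ i, e i ≠ 0 → ∃ n, i < n ∧ b n = e i := by
    intro i hi
    have hex : ∃ n, i < n ∧ e n ≠ e i :=
      ⟨N + i + 1, by omega, by rw [hN _ (by omega)]; exact hi.symm⟩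
    refine ⟨Nat.find hex, (Nat.find_spec hex).1, ?_⟩
    have hs := Nat.find_spec hex
    rcases hn : Nat.find hex with _ | n
    · omega
    · rw [hn] at hs
      have hmin := Nat.find_min hex (m := n) (by omega)
      have : e n = e i := by
        by_contra h
        rcases (Nat.lt_succ_iff_lt_or_eq.1 hs.1) with hlt | heq
        · exact hmin ⟨hlt, h⟩
        · exact h (heq ▸ rfl)
      rw [hB n (by rw [this]; exact hi) (by rw [this]; exact hs.2), this]
  have hall : ∀ j, ∃ n, j ≤ k → n ≤ g j ∧ (∀ l, j = l + 1 → g l < n) ∧ b n = -e (g j) := by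
    intro j
    by_cases hj : j ≤ k
    · rcases j with _ | l
      · obtain ⟨n, hn, hb⟩ := start (g 0) h2
        exact ⟨n, fun _ => ⟨hn, by simp, hb⟩⟩
      · have hx := hne l (by omega)
        have hl := h3 l (by omega)
        obtain ⟨n, hn1, hn2, hb⟩ := between (g l) (g (l + 1)) (h1 l (by omega)) (hne _ hj) (by
          rw [hl]
          exact SignType.ne_neg_self hx)
        exact ⟨n, fun _ => ⟨hn2, by rintro l' h; cases h; exact hn1, hb⟩⟩
    · exact ⟨0, fun h => absurd h hj⟩
  choose n hn using hall
  obtain ⟨z, hz, hbz⟩ := finish (g k) (hne k le_rfl)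
  refine ⟨fun j => if j ≤ k then n j else z, fun j hj => ?_, ?_, fun j hj => ?_⟩
  · by_cases hjk : j + 1 ≤ k
    · simp only [hjk, show j ≤ k by omega, if_true]
      exact (hn j (by omega)).1.trans_lt ((hn (j + 1) hjk).2.1 j rfl)
    · obtain rfl : j = k := by omega
      simpa using (hn j le_rfl).1.trans_lt hz
  · simp only [Nat.zero_le, if_true]
    rw [(hn 0 (Nat.zero_le k)).2.2]
    exact SignType.neg_ne_zero.2 h2
  · by_cases hjk : j + 1 ≤ k
    · simp only [hjk, show j ≤ k by omega, if_true]
      rw [(hn j (by omega)).2.2, (hn (j + 1) hjk).2.2, h3 j (by omega)]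
    · obtain rfl : j = k := by omega
      simp [(hn j le_rfl).2.2, hbz]

/-! ### Arithmetic of the signed tropical hyperfield -/

namespace TR

theorem eq_zero_or_of (a : TR) : a = 0 ∨ ∃ s r, a = of s r := by
  induction a using WithZero.recZeroCoe with
  | zero => exact Or.inl rfl
  | coe x => exact Or.inr ⟨x.1, x.2.toAdd, rfl⟩

@[simp] theorem of_ne_zero (s : ℤˣ) (r : ℝ) : of s r ≠ 0 := WithZero.coe_ne_zero

theorem of_mul_of (s s' : ℤˣ) (r r' : ℝ) : of s r * of s' r' = of (s * s') (r + r') := rfl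

@[simp] theorem of_inj {s s' : ℤˣ} {r r' : ℝ} : of s r = of s' r' ↔ s = s' ∧ r = r' := by
  simp [of]

theorem of_one_zero : of 1 0 = 1 := rfl

theorem of_pow (s : ℤˣ) (r : ℝ) (n : ℕ) : of s r ^ n = of (s ^ n) (n * r) := by
  induction n with
  | zero => simp [of_one_zero]
  | succ n ih => rw [pow_succ, ih, of_mul_of, pow_succ]; push_cast; ring_nf

@[simp] theorem val_zero : val 0 = ⊤ := rfl

@[simp] theorem val_of (s : ℤˣ) (r : ℝ) : val (of s r) = (r : WithTop ℝ) := rfl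

theorem val_mul (a b : TR) : val (a * b) = val a + val b := by
  rcases eq_zero_or_of a with rfl | ⟨s, r, rfl⟩
  · simp
  rcases eq_zero_or_of b with rfl | ⟨s', r', rfl⟩
  · simp
  · rw [of_mul_of]; simp

theorem val_eq_top {a : TR} : val a = ⊤ ↔ a = 0 := by
  rcases eq_zero_or_of a with rfl | ⟨s, r, rfl⟩ <;> simp

@[simp] theorem neg_zero : neg 0 = 0 := by simp [neg]

@[simp] theorem neg_of (s : ℤˣ) (r : ℝ) : neg (of s r) = of (-s) r := by
  simp [neg, of_mul_of]

@[simp] theorem neg_neg (a : TR) : neg (neg a) = a := by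
  rcases eq_zero_or_of a with rfl | ⟨s, r, rfl⟩ <;> simp

@[simp] theorem val_neg (a : TR) : val (neg a) = val a := by
  rcases eq_zero_or_of a with rfl | ⟨s, r, rfl⟩ <;> simp

theorem neg_mul (a b : TR) : neg a * b = neg (a * b) := by simp [neg, mul_assoc]

@[simp] theorem hadd_zero_left (b : TR) : hadd 0 b = {b} := rfl

@[simp] theorem hadd_zero_right (a : TR) : hadd a 0 = {a} := by
  rcases eq_zero_or_of a with rfl | ⟨s, r, rfl⟩ <;> rfl

theorem hadd_of_of (s s' : ℤˣ) (r r' : ℝ) : hadd (of s r) (of s' r') =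
    if r < r' then {of s r} else if r' < r then {of s' r'} else
      if s = s' then {of s r} else {z | (r : WithTop ℝ) ≤ val z} := rfl

theorem mem_hadd_mul_right {x y z w : TR} (hw : w ≠ 0) :
    z * w ∈ hadd (x * w) (y * w) ↔ z ∈ hadd x y := by
  rcases eq_zero_or_of w with rfl | ⟨s₃, r₃, rfl⟩
  · exact absurd rfl hw
  rcases eq_zero_or_of x with rfl | ⟨s, r, rfl⟩
  · simp
  rcases eq_zero_or_of y with rfl | ⟨s', r', rfl⟩
  · simp
  rw [of_mul_of, of_mul_of, hadd_of_of, hadd_of_of]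
  simp only [add_lt_add_iff_right, mul_left_inj]
  split_ifs
  · simp [← of_mul_of]
  · simp [← of_mul_of]
  · simp [← of_mul_of]
  · rcases eq_zero_or_of z with rfl | ⟨s₁, r₁, rfl⟩
    · simp
    · simp only [of_mul_of, Set.mem_ofPred_eq, val_of, WithTop.coe_le_coe, add_le_add_iff_right]

/-- Reversibility of the hyperaddition. -/
theorem neg_mem_hadd {x y z : TR} (h : z ∈ hadd (neg x) y) : neg x ∈ hadd (neg y) z := by
  rcases eq_zero_or_of x with rfl | ⟨s, r, rfl⟩
  · obtain rfl : z = y := by simpa using h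
    rcases eq_zero_or_of z with rfl | ⟨s, r, rfl⟩
    · simp
    · rw [neg_of, hadd_of_of]; simp
  rcases eq_zero_or_of y with rfl | ⟨s', r', rfl⟩
  · obtain rfl : z = of (-s) r := by simpa using h
    simp
  rw [neg_of, hadd_of_of] at h
  rw [neg_of, neg_of]
  rcases eq_zero_or_of z with rfl | ⟨s₁, r₁, rfl⟩
  · rw [hadd_zero_right]
    split_ifs at h with h1 h2 h3
    · exact absurd h.symm (of_ne_zero _ _)
    · exact absurd h.symm (of_ne_zero _ _)
    · exact absurd h.symm (of_ne_zero _ _)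
    · have : r = r' := by linarith
      have : s = s' := by
        rcases Int.units_eq_one_or s with rfl | rfl <;>
        rcases Int.units_eq_one_or s' with rfl | rfl <;> simp_all
      simp [*]
  · rw [hadd_of_of]
    split_ifs at h with h1 h2 h3
    · simp only [Set.mem_singleton_iff, of_inj] at h
      obtain ⟨rfl, rfl⟩ := h
      simp [h1, h1.not_gt]
    · simp only [Set.mem_singleton_iff, of_inj] at h
      obtain ⟨rfl, rfl⟩ := h
      have : s₁ ≠ -s₁ := by
        rcases Int.units_eq_one_or s₁ with rfl | rfl <;> decide
      simp [this.symm, h2.le]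
    · simp only [Set.mem_singleton_iff, of_inj] at h
      obtain ⟨rfl, rfl⟩ := h
      have : r₁ = r' := by linarith
      subst this
      subst h3
      have : s ≠ -s := by
        rcases Int.units_eq_one_or s with rfl | rfl <;> decide
      simp [this]
    · have : r = r' := by linarith
      subst this
      have : s = s' := by
        rcases Int.units_eq_one_or s with rfl | rfl <;>
        rcases Int.units_eq_one_or s' with rfl | rfl <;> simp_all
      subst this
      simp only [Set.mem_ofPred_eq, val_of, WithTop.coe_le_coe] at h
      rcases h.lt_or_eq with h | rfl
      · simp [h]
      · simp only [lt_irrefl, if_false]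
        split_ifs <;> simp

theorem mem_hadd_neg_self {c d : TR} (h : val d ≤ val c) : c ∈ hadd (neg d) d := by
  rcases eq_zero_or_of d with rfl | ⟨s, r, rfl⟩
  · simpa [val_eq_top] using h
  · have : -s ≠ s := by
      rcases Int.units_eq_one_or s with rfl | rfl <;> decide
    rw [neg_of, hadd_of_of]
    simpa [this] using h

theorem left_mem_hadd {c x : TR} (h : val c ≤ val x) : c ∈ hadd c x := by
  rcases eq_zero_or_of x with rfl | ⟨s', r', rfl⟩
  · simp
  rcases eq_zero_or_of c with rfl | ⟨s, r, rfl⟩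
  · simp at h
  simp only [val_of, WithTop.coe_le_coe] at h
  rw [hadd_of_of]
  split_ifs <;> simp
  linarith

theorem right_mem_hadd {c x : TR} (h : val c ≤ val x) : c ∈ hadd x c := by
  rcases eq_zero_or_of x with rfl | ⟨s', r', rfl⟩
  · simp
  rcases eq_zero_or_of c with rfl | ⟨s, r, rfl⟩
  · simp at h
  simp only [val_of, WithTop.coe_le_coe] at h
  rw [hadd_of_of]
  split_ifs <;> simp
  · linarith
  · rename_i h1 h2 h3
    exact ⟨h3.symm, by linarith⟩
  · linarith

/-- The sign of an element of valuation `m`; `0` for the elements of other valuations. -/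
noncomputable def signAt (m : ℝ) (a : TR) : SignType :=
  WithZero.recZeroCoe (motive := fun _ => SignType) 0
    (fun x => if x.2.toAdd = m then SignType.sign (x.1 : ℤ) else 0) a

@[simp] theorem signAt_zero (m : ℝ) : signAt m 0 = 0 := rfl

theorem signAt_of (m : ℝ) (s : ℤˣ) (r : ℝ) :
    signAt m (of s r) = if r = m then SignType.sign (s : ℤ) else 0 := rfl

theorem sign_unit_ne_zero (s : ℤˣ) : SignType.sign (s : ℤ) ≠ 0 := by
  rcases Int.units_eq_one_or s with rfl | rfl <;> decide

theorem sign_unit_inj {s s' : ℤˣ} :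
    SignType.sign (s : ℤ) = SignType.sign (s' : ℤ) ↔ s = s' := by
  rcases Int.units_eq_one_or s with rfl | rfl <;>
  rcases Int.units_eq_one_or s' with rfl | rfl <;> decide

theorem signAt_ne_zero {m : ℝ} {a : TR} : signAt m a ≠ 0 ↔ val a = m := by
  rcases eq_zero_or_of a with rfl | ⟨s, r, rfl⟩
  · simp
  · simp [signAt_of, sign_unit_ne_zero s]

@[simp] theorem signAt_neg (m : ℝ) (a : TR) : signAt m (neg a) = -signAt m a := by
  rcases eq_zero_or_of a with rfl | ⟨s, r, rfl⟩
  · simp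
  · simp only [neg_of, signAt_of, Units.val_neg, Left.sign_neg]
    split_ifs <;> simp

theorem eq_of_signAt_eq {m : ℝ} {a b : TR} (ha : signAt m a ≠ 0) (h : signAt m a = signAt m b) :
    a = b := by
  have hb : val b = m := signAt_ne_zero.1 (h ▸ ha)
  have ha' := signAt_ne_zero.1 ha
  rcases eq_zero_or_of a with rfl | ⟨s, r, rfl⟩
  · simp at ha'
  rcases eq_zero_or_of b with rfl | ⟨s', r', rfl⟩
  · simp at hb
  simp only [val_of, WithTop.coe_inj] at ha' hb
  subst ha'
  subst hb
  simp only [signAt_of, if_true, sign_unit_inj] at h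
  rw [h]

section hadd

variable {m : ℝ} {x y z : TR}

theorem le_val_of_mem_hadd (hx : m ≤ val x) (hy : m ≤ val y) (h : z ∈ hadd x y) : m ≤ val z := by
  rcases eq_zero_or_of x with rfl | ⟨s, r, rfl⟩
  · obtain rfl : z = y := by simpa using h
    exact hy
  rcases eq_zero_or_of y with rfl | ⟨s', r', rfl⟩
  · obtain rfl : z = of s r := by simpa using h
    exact hx
  rw [hadd_of_of] at h
  split_ifs at h
  · rw [h]; exact hx
  · rw [h]; exact hy
  · rw [h]; exact hx
  · exact hx.trans h

theorem signAt_hadd_eq_zero (hx : m ≤ val x) (hy : m ≤ val y) (h : z ∈ hadd x y)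
    (h1 : signAt m x = 0) (h2 : signAt m y = 0) : signAt m z = 0 := by
  have hx' : m < val x := hx.lt_of_ne fun h => signAt_ne_zero.2 h.symm h1
  have hy' : m < val y := hy.lt_of_ne fun h => signAt_ne_zero.2 h.symm h2
  by_contra hz
  have hz' := signAt_ne_zero.1 hz
  rcases eq_zero_or_of x with rfl | ⟨s, r, rfl⟩
  · obtain rfl : z = y := by simpa using h
    exact hz h2
  rcases eq_zero_or_of y with rfl | ⟨s', r', rfl⟩
  · obtain rfl : z = of s r := by simpa using h
    exact hz h1
  rw [hadd_of_of] at h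
  split_ifs at h
  · exact hz (h ▸ h1)
  · exact hz (h ▸ h2)
  · exact hz (h ▸ h1)
  · exact (hx'.trans_le h).ne' hz'

theorem signAt_hadd_left (hy : m ≤ val y) (h : z ∈ hadd x y) (h1 : signAt m x ≠ 0)
    (h2 : signAt m y ≠ -signAt m x) : signAt m z = signAt m x := by
  have hx := signAt_ne_zero.1 h1
  rcases eq_zero_or_of x with rfl | ⟨s, r, rfl⟩
  · simp at hx
  rcases eq_zero_or_of y with rfl | ⟨s', r', rfl⟩
  · obtain rfl : z = of s r := by simpa using h
    rfl
  simp only [val_of, WithTop.coe_inj, WithTop.coe_le_coe] at hx hy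
  subst hx
  rw [hadd_of_of] at h
  split_ifs at h with h3 h4 h5
  · rw [h]
  · linarith
  · rw [h]
  · exfalso
    have : r' = r := by linarith
    subst this
    apply h2
    simp only [signAt_of, if_true]
    rcases Int.units_eq_one_or s with rfl | rfl <;>
    rcases Int.units_eq_one_or s' with rfl | rfl <;> simp_all

theorem signAt_hadd_right (hx : m ≤ val x) (h : z ∈ hadd x y) (h1 : signAt m y ≠ 0)
    (h2 : signAt m x ≠ -signAt m y) : signAt m z = signAt m y := by
  have hy := signAt_ne_zero.1 h1
  rcases eq_zero_or_of y with rfl | ⟨s, r, rfl⟩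
  · simp at hy
  rcases eq_zero_or_of x with rfl | ⟨s', r', rfl⟩
  · obtain rfl : z = of s r := by simpa using h
    rfl
  simp only [val_of, WithTop.coe_inj, WithTop.coe_le_coe] at hx hy
  subst hy
  rw [hadd_of_of] at h
  split_ifs at h with h3 h4 h5
  · linarith
  · rw [h]
  · rw [h, h5, show r' = r by linarith]
  · exfalso
    have : r' = r := by linarith
    subst this
    apply h2
    simp only [signAt_of, if_true]
    rcases Int.units_eq_one_or s with rfl | rfl <;>
    rcases Int.units_eq_one_or s' with rfl | rfl <;> simp_all

end hadd

end TR

/-! ### Division by `x - 1` over the signed tropical hyperfield -/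

namespace TR

/-- `m` is the least valuation of a term of the sequence `c`. -/
def IsLevel (c : ℕ → TR) (m : ℝ) : Prop :=
  (∀ i, (m : WithTop ℝ) ≤ val (c i)) ∧ ∃ i, val (c i) = m

/-- The relation `c ∈ (x - 1) d` for sequences of coefficients. -/
def IsLinMul (c d : ℕ → TR) : Prop :=
  c 0 = neg (d 0) ∧ ∀ i, c (i + 1) ∈ hadd (neg (d (i + 1))) (d i)

theorem exists_isLevel {c : ℕ → TR} {N : ℕ} (hN : ∀ i, N < i → c i = 0) (hc : ∃ i, c i ≠ 0) :
    ∃ m, IsLevel c m := by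
  obtain ⟨i₀, hi₀⟩ := hc
  obtain ⟨i, -, hi⟩ := Finset.exists_min_image (Finset.range (N + 1)) (fun i => val (c i))
    ⟨0, by simp⟩
  have hmin : ∀ j, val (c i) ≤ val (c j) := by
    intro j
    by_cases hj : j ≤ N
    · exact hi j (by simpa [Nat.lt_succ_iff] using hj)
    · rw [hN j (by omega)]; exact le_top
  have hne : val (c i) ≠ ⊤ := fun h => hi₀ (val_eq_top.1 (top_le_iff.1 (h ▸ hmin i₀)))
  obtain ⟨m, hm⟩ := WithTop.ne_top_iff_exists.1 hne
  exact ⟨m, fun j => hm ▸ hmin j, i, hm.symm⟩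

theorem IsLevel.unique {c : ℕ → TR} {m m' : ℝ} (h : IsLevel c m) (h' : IsLevel c m') : m = m' := by
  obtain ⟨i, hi⟩ := h.2
  obtain ⟨j, hj⟩ := h'.2
  have h1 := h.1 j
  have h2 := h'.1 i
  rw [hj] at h1
  rw [hi] at h2
  exact le_antisymm (WithTop.coe_le_coe.1 h1) (WithTop.coe_le_coe.1 h2)

theorem IsLevel.hasAlternation_zero {c : ℕ → TR} {m : ℝ} (h : IsLevel c m) :
    HasAlternation (fun i => signAt m (c i)) 0 :=
  hasAlternation_zero_iff.2 (h.2.imp fun _ => signAt_ne_zero.2)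

theorem IsLinMul.hasAlternation {c d : ℕ → TR} (h : IsLinMul c d) {m : ℝ} {N k : ℕ}
    (hm : ∀ i, (m : WithTop ℝ) ≤ val (d i)) (hN : ∀ i, N ≤ i → d i = 0)
    (hd : HasAlternation (fun i => signAt m (d i)) k) :
    HasAlternation (fun i => signAt m (c i)) (k + 1) := by
  refine hd.succ_of_linMul (N := N) (by simp [h.1]) (fun i h1 h2 => ?_) (fun i h1 h2 => ?_)
    (fun i hi => by simp [hN i hi])
  · have := signAt_hadd_left (hm i) (h.2 i) (by rw [signAt_neg]; exact SignType.neg_ne_zero.2 h1)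
      (by simpa using h2)
    simpa using this
  · exact signAt_hadd_right (by simpa using hm (i + 1)) (h.2 i) h1 (by simpa using h2)

theorem IsLinMul.le_val {c d : ℕ → TR} (h : IsLinMul c d) {m : ℝ}
    (hm : ∀ i, (m : WithTop ℝ) ≤ val (d i)) (i : ℕ) : (m : WithTop ℝ) ≤ val (c i) := by
  rcases i with _ | i
  · simpa [h.1] using hm 0
  · exact le_val_of_mem_hadd (by simpa using hm (i + 1)) (hm i) (h.2 i)

/-- A quotient by `x - 1` has the same least valuation. -/
theorem IsLinMul.isLevel {c d : ℕ → TR} (h : IsLinMul c d) {m : ℝ} {N : ℕ} (hc : IsLevel c m)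
    (hN : ∀ i, N ≤ i → d i = 0) : IsLevel d m := by
  have hd : ∃ i, d i ≠ 0 := by
    by_contra! h0
    obtain ⟨i, hi⟩ := hc.2
    have : c i = 0 := by
      rcases i with _ | i
      · simp [h.1, h0]
      · simpa [h0] using h.2 i
    simp [this] at hi
  obtain ⟨m', hm'⟩ := exists_isLevel (N := N) (fun i hi => hN i hi.le) hd
  have halt := h.hasAlternation hm'.1 hN hm'.hasAlternation_zero
  obtain ⟨i, hi⟩ := hasAlternation_zero_iff.1 (halt.mono (Nat.zero_le _))
  have : IsLevel c m' := ⟨h.le_val hm'.1, i, signAt_ne_zero.1 hi⟩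
  rwa [hc.unique this]

/-- The negated coefficients of the quotient by `x - 1` are partial hypersums. -/
theorem IsLinMul.neg_mem_hsum {c d : ℕ → TR} (h : IsLinMul c d) (n : ℕ) :
    neg (d n) ∈ hsum c (n + 1) := by
  induction n with
  | zero => simp [hsum, h.1]
  | succ n ih =>
    rw [hsum]
    exact Set.mem_biUnion ih (neg_mem_hadd (h.2 n))

/-- A hypersum without terms of opposite sign at the least valuation does not contain `∞`. -/
theorem hasAlternation_one_of_zero_mem_hsum {c : ℕ → TR} {m : ℝ} {N : ℕ} (hc : IsLevel c m)
    (hN : ∀ i, N < i → c i = 0) (h : 0 ∈ hsum c (N + 1)) :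
    HasAlternation (fun i => signAt m (c i)) 1 := by
  by_contra hno
  obtain ⟨i₀, hi₀⟩ := hc.2
  have hs₀ := signAt_ne_zero.2 hi₀
  have hsame : ∀ j, signAt m (c j) ≠ -signAt m (c i₀) := by
    intro j hj
    apply hno
    rcases lt_trichotomy i₀ j with hlt | rfl | hlt
    · exact ⟨fun n => if n = 0 then i₀ else j, by simpa using hlt, by simpa using hs₀,
        by simpa using hj⟩
    · exact absurd hj (SignType.ne_neg_self hs₀)
    · exact ⟨fun n => if n = 0 then j else i₀, by simpa using hlt,
        by simpa [hj] using SignType.neg_ne_zero.2 hs₀, by simp [hj]⟩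
  have key : ∀ n, ∀ b ∈ hsum c n, (m : WithTop ℝ) ≤ val b ∧ signAt m b ≠ -signAt m (c i₀) ∧
      (i₀ < n → signAt m b = signAt m (c i₀)) := by
    intro n
    induction n with
    | zero =>
      intro b hb
      obtain rfl : b = 0 := by simpa [hsum] using hb
      exact ⟨by simp, by simpa using (SignType.neg_ne_zero.2 hs₀).symm, by simp⟩
    | succ n ih =>
      intro b hb
      rw [hsum] at hb
      obtain ⟨b', hb', hb⟩ := Set.mem_iUnion₂.1 hb
      obtain ⟨h1, h2, h3⟩ := ih b' hb'
      refine ⟨le_val_of_mem_hadd h1 (hc.1 n) hb, ?_⟩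
      have hn := hsame n
      have signs : ∀ x y : SignType, y ≠ 0 → x ≠ -y → x = 0 ∨ x = y := by decide
      rcases signs _ _ hs₀ h2 with h4 | h4
      · have hlt : ¬ i₀ < n := fun h => hs₀ (h4 ▸ h3 h).symm
        rcases signs _ _ hs₀ hn with h5 | h5
        · have hne : n ≠ i₀ := by rintro rfl; exact hs₀ h5
          rw [signAt_hadd_eq_zero h1 (hc.1 n) hb h4 h5]
          exact ⟨(SignType.neg_ne_zero.2 hs₀).symm, fun h6 => absurd h6 (by omega)⟩
        · have := signAt_hadd_right h1 hb (by rwa [h5]) (by rwa [h5])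
          rw [this, h5]
          exact ⟨SignType.ne_neg_self hs₀, fun _ => rfl⟩
      · have := signAt_hadd_left (hc.1 n) hb (by rwa [h4]) (by rwa [h4])
        rw [this, h4]
        exact ⟨SignType.ne_neg_self hs₀, fun _ => rfl⟩
  obtain ⟨-, -, h3⟩ := key (N + 1) 0 h
  have hlt : i₀ < N + 1 := by
    by_contra hle
    rw [hN i₀ (by omega)] at hi₀
    simp at hi₀
  exact hs₀ (h3 hlt).symm

end TR

namespace TR

/-- Dividing `c` by `x - 1` from the constant term upwards. -/
noncomputable def quotUp (c : ℕ → TR) : ℕ → TR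
  | 0 => neg (c 0)
  | i + 1 => if val (quotUp c i) ≤ val (c (i + 1)) then quotUp c i else neg (c (i + 1))

/-- Dividing `c`, of degree at most `N`, by `x - 1` from the leading term downwards; the
`n`-th value is the coefficient of `x ^ (N - n)` in the quotient. -/
noncomputable def quotDownAux (c : ℕ → TR) (N : ℕ) : ℕ → TR
  | 0 => 0
  | n + 1 => if val (c (N - n)) ≤ val (quotDownAux c N n) then c (N - n) else quotDownAux c N n

theorem mem_hadd_quotUp (c : ℕ → TR) (i : ℕ) :
    c (i + 1) ∈ hadd (neg (quotUp c (i + 1))) (quotUp c i) := by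
  rw [quotUp]
  split_ifs with h
  · exact mem_hadd_neg_self h
  · rw [neg_neg]
    exact left_mem_hadd (not_le.1 h).le

/-- The upward quotient keeps the sign of the first term of least valuation. -/
theorem quotUp_eq {c : ℕ → TR} {m : ℝ} (hc : IsLevel c m) {i₀ : ℕ} (h₀ : val (c i₀) = m)
    (hlt : ∀ i < i₀, val (c i) ≠ m) {i : ℕ} (hi : i₀ ≤ i) : quotUp c i = neg (c i₀) := by
  have hbefore : ∀ i < i₀, m < val (quotUp c i) := by
    intro i hi
    induction i with
    | zero => simpa [quotUp] using (hc.1 0).lt_of_ne (hlt 0 hi).symm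
    | succ i ih =>
      rw [quotUp]
      split_ifs
      · exact ih (by omega)
      · simpa using (hc.1 _).lt_of_ne (hlt _ hi).symm
  induction i, hi using Nat.le_induction with
  | base =>
    rcases i₀ with _ | i
    · rfl
    · rw [quotUp, if_neg]
      rw [h₀]
      exact (hbefore i (by omega)).not_ge
  | succ i hi ih =>
    rw [quotUp, ih, if_pos]
    rw [val_neg, h₀]
    exact hc.1 _

/-- The coefficient of `x ^ i` in the downward quotient. -/
noncomputable def quotDown (c : ℕ → TR) (N i : ℕ) : TR := quotDownAux c N (N - i)

theorem quotDown_eq_zero {c : ℕ → TR} {N i : ℕ} (hi : N ≤ i) : quotDown c N i = 0 := by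
  rw [quotDown, Nat.sub_eq_zero_of_le hi]; rfl

theorem quotDown_rec {c : ℕ → TR} {N : ℕ} (hN : ∀ i, N < i → c i = 0) (i : ℕ) :
    quotDown c N i = if val (c (i + 1)) ≤ val (quotDown c N (i + 1)) then c (i + 1)
      else quotDown c N (i + 1) := by
  by_cases hi : i < N
  · rw [quotDown, quotDown, show N - i = N - (i + 1) + 1 by omega, quotDownAux,
      show N - (N - (i + 1)) = i + 1 by omega]
  · rw [quotDown_eq_zero (by omega), quotDown_eq_zero (by omega), hN _ (by omega)]
    simp

theorem mem_hadd_quotDown {c : ℕ → TR} {N : ℕ} (hN : ∀ i, N < i → c i = 0) (i : ℕ) :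
    c (i + 1) ∈ hadd (neg (quotDown c N (i + 1))) (quotDown c N i) := by
  rw [quotDown_rec hN i]
  split_ifs with h
  · exact right_mem_hadd (by simpa using h)
  · exact mem_hadd_neg_self (not_le.1 h).le

theorem le_val_quotDown {c : ℕ → TR} {m : ℝ} (hc : ∀ i, (m : WithTop ℝ) ≤ val (c i)) (N i : ℕ) :
    (m : WithTop ℝ) ≤ val (quotDown c N i) := by
  rw [quotDown]
  induction N - i with
  | zero => simp [quotDownAux]
  | succ n ih =>
    rw [quotDownAux]
    split_ifs
    · exact hc _
    · exact ih

/-- A term of least valuation becomes the preceding coefficient of the downward quotient. -/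
theorem quotDown_eq {c : ℕ → TR} {m : ℝ} {N : ℕ} (hc : IsLevel c m) (hN : ∀ i, N < i → c i = 0)
    {i : ℕ} (hi : val (c (i + 1)) = m) : quotDown c N i = c (i + 1) := by
  rw [quotDown_rec hN, if_pos]
  rw [hi]
  exact le_val_quotDown hc.1 _ _

/-- If `c` has a sign change at its least valuation, then it has a quotient by `x - 1` that loses only
one sign change. The quotient is computed upwards from the constant term as far as a term of least
valuation whose sign is opposite to that of the first such term, and downwards from the leading term
beyond it; the two agree at the junction. -/
theorem exists_isLinMul {c : ℕ → TR} {m : ℝ} {N k : ℕ} (hc : IsLevel c m)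
    (hN : ∀ i, N < i → c i = 0) (h : HasAlternation (fun i => signAt m (c i)) (k + 1)) :
    ∃ d, IsLinMul c d ∧ (∀ i, N ≤ i → d i = 0) ∧ HasAlternation (fun i => signAt m (d i)) k := by
  classical
  obtain ⟨g, h1, h2, h3⟩ := h
  have hlev : ∀ j ≤ k + 1, val (c (g j)) = m := fun j hj =>
    signAt_ne_zero.1 (alternation_ne_zero (b := fun i => signAt m (c i)) h2 h3 hj)
  have hex : ∃ i, val (c i) = m := hc.2
  set i₀ := Nat.find hex with hi₀
  have hs : val (c i₀) = m := Nat.find_spec hex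
  have hs0 := signAt_ne_zero.2 hs
  have hmin : ∀ i < i₀, val (c i) ≠ m := fun i hi => Nat.find_min hex hi
  have hle : i₀ ≤ g 0 := Nat.find_min' hex (hlev 0 (by omega))
  have hg1 : g 0 < g 1 := h1 0 (by omega)
  -- One of the opposite signs at `g 0` and `g 1` is opposite to the sign at `i₀`.
  obtain ⟨j, hj0, hjg, hcj⟩ : ∃ j, i₀ ≤ j ∧ j + 1 ≤ g 1 ∧ c (j + 1) = neg (c i₀) := by
    have signs : ∀ x y : SignType, x ≠ 0 → y ≠ 0 → x = -y ∨ -x = -y := by decide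
    rcases signs (signAt m (c (g 0))) (signAt m (c i₀)) h2 hs0 with h | h
    · have hne : i₀ ≠ g 0 := by
        intro he
        rw [← he] at h
        exact SignType.ne_neg_self hs0 h
      refine ⟨g 0 - 1, by omega, by omega, ?_⟩
      rw [show g 0 - 1 + 1 = g 0 by omega]
      exact eq_of_signAt_eq h2 (by rw [signAt_neg, h])
    · have h' : signAt m (c (g 1)) = -signAt m (c (g 0)) := h3 0 (by omega)
      refine ⟨g 1 - 1, by omega, by omega, ?_⟩
      rw [show g 1 - 1 + 1 = g 1 by omega]
      exact eq_of_signAt_eq (signAt_ne_zero.2 (hlev 1 (by omega))) (by rw [signAt_neg, ← h, h'])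
  have hup : quotUp c j = neg (c i₀) := quotUp_eq hc hs hmin hj0
  have hdown : quotDown c N j = neg (c i₀) := by
    rw [quotDown_eq hc hN (by rw [hcj, val_neg, hs]), hcj]
  set d : ℕ → TR := fun i => if i ≤ j then quotUp c i else quotDown c N i with hd
  have hd_down : ∀ i, j ≤ i → d i = quotDown c N i := by
    intro i hi
    rcases hi.eq_or_lt with rfl | hi
    · simp only [hd, le_refl, if_true]
      rw [hup, hdown]
    · simp [hd, hi.not_ge]
  have hjN : j + 1 ≤ N := by
    by_contra hlt
    have := hN (j + 1) (by omega)
    rw [this] at hcj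
    rw [← val_neg, ← hcj] at hs
    simp at hs
  have hgj : ∀ l, l ≤ k → j + 1 ≤ g (l + 1) := by
    intro l
    induction l with
    | zero => intro _; exact hjg
    | succ l ih =>
      intro hl
      exact (ih (by omega)).trans (h1 (l + 1) (by omega)).le
  have hdg : ∀ l ≤ k, signAt m (d (g (l + 1) - 1)) = signAt m (c (g (l + 1))) := by
    intro l hl
    have := hgj l hl
    rw [hd_down _ (by omega), quotDown_eq hc hN, show g (l + 1) - 1 + 1 = g (l + 1) by omega]
    rw [show g (l + 1) - 1 + 1 = g (l + 1) by omega]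
    exact hlev _ (by omega)
  refine ⟨d, ⟨?_, fun i => ?_⟩, fun i hi => ?_, fun l => g (l + 1) - 1, fun l hl => ?_, ?_,
    fun l hl => ?_⟩
  · simp [hd, quotUp]
  · by_cases hi : i + 1 ≤ j
    · simp only [hd, hi, show i ≤ j by omega, if_true]
      exact mem_hadd_quotUp c i
    · rw [hd_down _ (by omega), hd_down _ (by omega)]
      exact mem_hadd_quotDown hN i
  · rw [hd_down _ (by omega), quotDown_eq_zero hi]
  · have := hgj l hl.le
    have := h1 (l + 1) (by omega)
    dsimp only
    omega
  · dsimp only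
    rw [hdg 0 (by omega)]
    exact signAt_ne_zero.2 (hlev 1 (by omega))
  · dsimp only
    rw [hdg _ hl.le, hdg _ hl]
    exact h3 (l + 1) (by omega)

end TR

/-! ### Multiplicities over the signed tropical hyperfield -/

namespace TRPoly

open TR

theorem apply_eq_zero_of_natDegree_lt {p : TRPoly} {i : ℕ} (hi : p.natDegree < i) : p i = 0 := by
  by_contra h
  have : i ≤ p.natDegree := Finset.le_sup (f := id) (Finsupp.mem_support_iff.2 h)
  omega

/-- Substituting `a x` for `x` turns a factor `x - a` into `x - 1`. -/
theorem memLinMul_iff {p q : TRPoly} {a : TR} (ha : a ≠ 0) :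
    p.MemLinMul a q ↔ IsLinMul (fun i => p i * a ^ i) (fun i => q i * a ^ (i + 1)) := by
  refine and_congr ?_ (forall_congr' fun i => ?_)
  · simp [mul_comm a]
  · rw [← mem_hadd_mul_right (pow_ne_zero (i + 1) ha), TR.neg_mul]
    dsimp only
    rw [show q (i + 1) * a ^ (i + 1 + 1) = a * q (i + 1) * a ^ (i + 1) by
      rw [pow_succ _ (i + 1), mul_comm a, mul_assoc, mul_comm a]]

theorem signAt_mul_of (m : ℝ) (x : TR) (s : ℤˣ) (r : ℝ) :
    signAt (m + r) (x * of s r) = signAt m x * SignType.sign (s : ℤ) := by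
  rcases eq_zero_or_of x with rfl | ⟨s', r', rfl⟩
  · simp
  · simp only [of_mul_of, signAt_of, add_left_inj, Units.val_mul, sign_mul]
    split_ifs <;> simp

/-- Descartes' rule of signs over the signed tropical hyperfield: the multiplicity of `a` as a root
of `p` is the number of sign changes among the terms of `p(a)` of least valuation. -/
theorem le_mult_iff {p : TRPoly} {a : TR} (ha : a ≠ 0) {m : ℝ}
    (hp : IsLevel (fun i => p i * a ^ i) m) (k : ℕ) :
    (k : ℕ∞) ≤ mult a p ↔ HasAlternation (fun i => signAt m (p i * a ^ i)) k := by
  induction k generalizing p m with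
  | zero => simpa using hp.hasAlternation_zero
  | succ k ih =>
    have hpN : ∀ i, p.natDegree < i → p i * a ^ i = 0 := fun i hi => by
      rw [apply_eq_zero_of_natDegree_lt hi, zero_mul]
    -- For a quotient `q`, the inductive statement in terms of the coefficients of `a q(a x)`.
    have ih' : ∀ q : TRPoly, p.MemLinMul a q → ((k : ℕ∞) ≤ mult a q ↔
        HasAlternation (fun i => signAt m (q i * a ^ (i + 1))) k) := by
      intro q hpq
      have hN : ∀ i, q.natDegree + 1 ≤ i → q i * a ^ (i + 1) = 0 := fun i hi => by
        rw [apply_eq_zero_of_natDegree_lt hi, zero_mul]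
      have hlev := ((memLinMul_iff ha).1 hpq).isLevel hp hN
      obtain ⟨s, r, rfl⟩ := (eq_zero_or_of a).resolve_left ha
      have hlev' : IsLevel (fun i => q i * of s r ^ i) (m - r) := by
        have hval : ∀ i, val (q i * of s r ^ (i + 1)) = val (q i * of s r ^ i) + (r : WithTop ℝ) :=
          fun i => by rw [pow_succ, ← mul_assoc, val_mul, val_of]
        have hm : (m : WithTop ℝ) = ((m - r : ℝ) : WithTop ℝ) + (r : WithTop ℝ) := by
          rw [← WithTop.coe_add, sub_add_cancel]
        refine ⟨fun i => ?_, hlev.2.imp fun i hi => ?_⟩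
        · have := hlev.1 i
          rw [hval, hm] at this
          exact (WithTop.add_le_add_iff_right WithTop.coe_ne_top).1 this
        · rw [hval, hm] at hi
          exact (WithTop.add_right_inj WithTop.coe_ne_top).1 hi
      rw [ih hlev', ← hasAlternation_mul_iff (sign_unit_ne_zero s)]
      have : ∀ i, signAt (m - r) (q i * of s r ^ i) * SignType.sign (s : ℤ) =
          signAt m (q i * of s r ^ (i + 1)) := fun i => by
        rw [← signAt_mul_of, sub_add_cancel, pow_succ, mul_assoc]
      simp only [this]
    constructor
    · intro h
      rw [mult_eq] at h
      split_ifs at h with h0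
      · rcases k with _ | k
        · exact hasAlternation_one_of_zero_mem_hsum hp hpN h0
        · have h' : ((k + 1 : ℕ) : ℕ∞) ≤ ⨆ (q : TRPoly) (_ : p.MemLinMul a q), mult a q := by
            rw [add_comm 1] at h
            push_cast at h ⊢
            exact (ENat.add_le_add_iff_right ENat.one_ne_top).1 h
          have hlt : (k : ℕ∞) < ⨆ (q : TRPoly) (_ : p.MemLinMul a q), mult a q :=
            lt_of_lt_of_le (by exact_mod_cast Nat.lt_succ_self k) h'
          obtain ⟨q, hq⟩ := lt_iSup_iff.1 hlt
          obtain ⟨hpq, hq⟩ := lt_iSup_iff.1 hq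
          have hk := (ih' q hpq).1 (by push_cast; exact Order.add_one_le_of_lt hq)
          have hN : ∀ i, q.natDegree + 1 ≤ i → q i * a ^ (i + 1) = 0 := fun i hi => by
            rw [apply_eq_zero_of_natDegree_lt hi, zero_mul]
          have hlin := (memLinMul_iff ha).1 hpq
          exact hlin.hasAlternation (hlin.isLevel hp hN).1 hN hk
      · simp at h
    · intro h
      obtain ⟨d, hlin, hdN, hd⟩ := exists_isLinMul hp hpN h
      set q : TRPoly := Finsupp.ofSupportFinite (fun i => d i * (a ^ (i + 1))⁻¹)
        ((Set.finite_lt_nat p.natDegree).subset fun i hi => by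
          by_contra hlt
          exact hi (by simp [hdN i (not_lt.1 hlt)])) with hq
      have hqd : ∀ i, q i * a ^ (i + 1) = d i := fun i => by
        rw [hq, Finsupp.ofSupportFinite_coe]
        exact inv_mul_cancel_right₀ (pow_ne_zero _ ha) _
      have hpq : p.MemLinMul a q := by
        rw [memLinMul_iff ha]
        simpa only [hqd] using hlin
      have h0 : 0 ∈ p.evalSet a := by
        have := hlin.neg_mem_hsum p.natDegree
        rwa [hdN _ le_rfl, TR.neg_zero] at this
      rw [mult_eq, if_pos h0]
      push_cast
      rw [add_comm]
      gcongr
      refine le_trans ((ih' q hpq).2 ?_) (le_iSup₂ (f := fun q _ => mult a q) q hpq)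
      simpa only [hqd] using hd

end TRPoly

/-! ### Positive roots of real polynomials -/

open Polynomial in
/-- Descartes' rule of signs: a nonzero real polynomial with `k` positive roots has `k` sign
changes. -/
theorem hasAlternation_of_prod_dvd (Z : Multiset ℝ) (hZ : ∀ z ∈ Z, 0 < z) {f : ℝ[X]} (hf : f ≠ 0)
    (h : (Z.map fun z => X - C z).prod ∣ f) :
    HasAlternation (fun i => SignType.sign (f.coeff i)) (Multiset.card Z) := by
  induction Z using Multiset.induction generalizing f with
  | empty =>
    refine hasAlternation_zero_iff.2 ⟨f.natDegree, ?_⟩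
    simpa [sign_eq_zero_iff] using hf
  | cons z Z ih =>
    rw [Multiset.map_cons, Multiset.prod_cons] at h
    obtain ⟨u, rfl⟩ := h
    rw [mul_assoc] at hf ⊢
    set v := (Z.map fun z => X - C z).prod * u with hv
    have hz : 0 < z := hZ z (by simp)
    rw [Multiset.card_cons]
    refine (ih (fun y hy => hZ y (by simp [hy])) (right_ne_zero_of_mul hf)
      (Dvd.intro _ rfl)).succ_of_linMul (N := v.natDegree + 1) ?_ ?_ ?_ ?_
    · have : ((X - C z) * v).coeff 0 = -(z * v.coeff 0) := by
        rw [mul_coeff_zero]; simp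
      rw [this, Left.sign_neg, sign_mul, sign_pos hz, one_mul]
    · intro i h1 h2
      rw [coeff_X_sub_C_mul]
      rcases lt_or_gt_of_ne (sign_ne_zero.1 h1) with h3 | h3
      · rw [sign_neg h3] at h2 ⊢
        have h4 : 0 ≤ v.coeff i := not_lt.1 fun h => h2 (sign_neg h)
        exact sign_pos (by nlinarith)
      · rw [sign_pos h3] at h2 ⊢
        have h4 : v.coeff i ≤ 0 := not_lt.1 fun h => h2 (sign_pos h)
        exact sign_neg (by nlinarith)
    · intro i h1 h2
      rw [coeff_X_sub_C_mul]
      rcases lt_or_gt_of_ne (sign_ne_zero.1 h1) with h3 | h3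
      · rw [sign_neg h3] at h2 ⊢
        have h4 : 0 ≤ v.coeff (i + 1) := not_lt.1 fun h => h2 (sign_neg h)
        exact sign_neg (by nlinarith)
      · rw [sign_pos h3] at h2 ⊢
        have h4 : v.coeff (i + 1) ≤ 0 := not_lt.1 fun h => h2 (sign_pos h)
        exact sign_pos (by nlinarith)
    · intro i hi
      rw [coeff_eq_zero_of_natDegree_lt (by omega), sign_zero]

/-- The weight `4 ^ (-i ^ 2)` of the `i`-th coefficient. -/
noncomputable def gaussWeight (i : ℕ) : ℝ := (4 : ℝ) ^ (-(i : ℤ) ^ 2)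

theorem gaussWeight_pos (i : ℕ) : 0 < gaussWeight i := by unfold gaussWeight; positivity

/-- The terms `4 ^ (-j ^ 2) x ^ j` at `x = 16 ^ i`, relative to the one with `j = i`. -/
theorem gaussWeight_mul_pow (i j : ℕ) :
    gaussWeight j * (16 ^ i) ^ j = (4 : ℝ) ^ ((i : ℤ) ^ 2) * 4 ^ (-((j : ℤ) - i) ^ 2) := by
  have h : ((16 : ℝ) ^ i) ^ j = 4 ^ (2 * (i : ℤ) * j) := by
    rw [show (2 * (i : ℤ) * j) = ((2 * i * j : ℕ) : ℤ) by push_cast; ring, zpow_natCast,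
      ← pow_mul, mul_assoc, pow_mul 4 2]
    norm_num
  rw [h, gaussWeight, ← zpow_add₀ (by norm_num), ← zpow_add₀ (by norm_num)]
  ring_nf

theorem sum_gauss_lt_two (i n : ℕ) :
    ∑ j ∈ Finset.range n, (4 : ℝ) ^ (-((j : ℤ) - i) ^ 2) < 2 := by
  -- The terms with `j ≠ i` are bounded by two geometric series of ratio `1 / 4`.
  have h : ∀ n : ℕ, ∑ j ∈ Finset.range n, (4 : ℝ) ^ (-((j : ℤ) - i) ^ 2) ≤
      if n ≤ i then (4 : ℝ) ^ ((n : ℤ) - i) / 3 else 5 / 3 - (4 : ℝ) ^ ((i : ℤ) + 1 - n) / 3 := by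
    intro n
    induction n with
    | zero => simp only [Finset.range_zero, Finset.sum_empty, Nat.zero_le, if_true]; positivity
    | succ n ih =>
      rw [Finset.sum_range_succ]
      have four : ∀ k : ℤ, (4 : ℝ) ^ (k + 1) = 4 * 4 ^ k := fun k => by
        rw [zpow_add₀ (by norm_num)]; ring
      rcases lt_trichotomy n i with hlt | rfl | hlt
      · rw [if_pos hlt.le] at ih
        rw [if_pos (show n + 1 ≤ i from hlt)]
        have hz : (4 : ℝ) ^ (-((n : ℤ) - i) ^ 2) ≤ 4 ^ ((n : ℤ) - i) :=
          zpow_le_zpow_right₀ (by norm_num) (by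
            have : (n : ℤ) - i ≤ -1 := by omega
            nlinarith)
        have := four ((n : ℤ) - i)
        rw [show ((n + 1 : ℕ) : ℤ) - i = (n : ℤ) - i + 1 by push_cast; ring]
        linarith
      · rw [if_pos le_rfl] at ih
        rw [if_neg (by omega)]
        push_cast
        simp only [sub_self, zpow_zero] at ih ⊢
        norm_num at ih ⊢
        linarith
      · rw [if_neg (by omega)] at ih
        rw [if_neg (by omega)]
        have hz : (4 : ℝ) ^ (-((n : ℤ) - i) ^ 2) ≤ 4 ^ ((i : ℤ) - n) :=
          zpow_le_zpow_right₀ (by norm_num) (by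
            have : (1 : ℤ) ≤ n - i := by omega
            nlinarith)
        have := four ((i : ℤ) - n)
        rw [show (i : ℤ) - n + 1 = i + 1 - n by ring] at this
        rw [show (i : ℤ) + 1 - (n + 1 : ℕ) = (i : ℤ) - n by push_cast; ring]
        linarith
  refine (h n).trans_lt ?_
  split_ifs with hn
  · have : (4 : ℝ) ^ ((n : ℤ) - i) ≤ 1 := zpow_le_one_of_nonpos₀ (by norm_num) (by omega)
    linarith
  · have : (0 : ℝ) < (4 : ℝ) ^ ((i : ℤ) + 1 - n) := by positivity
    linarith

open Polynomial in
/-- For coefficients `± 4 ^ (-i ^ 2)` or `0`, the `i`-th term dominates at `16 ^ i`. -/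
theorem sign_eval_of_gaussWeight {b : ℕ → SignType} {f : ℝ[X]}
    (hf : ∀ i, f.coeff i = b i * gaussWeight i) {i : ℕ} (hi : b i ≠ 0) :
    SignType.sign (f.eval (16 ^ i)) = b i := by
  have habs : ∀ x : SignType, |(x : ℝ)| ≤ 1 := by intro x; cases x <;> simp
  have hcast : ∀ x : SignType, x ≠ 0 → (x : ℝ) ≠ 0 := by
    intro x
    cases x
    all_goals simp
  have hin : i ∈ Finset.range (f.natDegree + 1) := by
    rw [Finset.mem_range, Nat.lt_succ_iff]
    refine le_natDegree_of_ne_zero ?_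
    rw [hf]
    exact mul_ne_zero (hcast _ hi) (gaussWeight_pos i).ne'
  set S := ∑ j ∈ (Finset.range (f.natDegree + 1)).erase i,
    (b j : ℝ) * 4 ^ (-((j : ℤ) - i) ^ 2) with hS
  have heval : f.eval (16 ^ i) = (4 : ℝ) ^ ((i : ℤ) ^ 2) * (b i + S) := by
    rw [eval_eq_sum_range, ← Finset.add_sum_erase _ _ hin, mul_add, hS, Finset.mul_sum]
    congr 1
    · rw [hf, mul_assoc, gaussWeight_mul_pow]
      simp
      ring
    · refine Finset.sum_congr rfl fun j _ => ?_
      rw [hf, mul_assoc, gaussWeight_mul_pow]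
      ring
  have hSlt : |S| < 1 := by
    have h2 := sum_gauss_lt_two i (f.natDegree + 1)
    rw [← Finset.add_sum_erase _ _ hin] at h2
    have h0 : (4 : ℝ) ^ (-((i : ℤ) - i) ^ 2) = 1 := by simp
    rw [h0] at h2
    refine (Finset.abs_sum_le_sum_abs _ _).trans_lt (lt_of_le_of_lt ?_
      (show ∑ j ∈ (Finset.range (f.natDegree + 1)).erase i,
        (4 : ℝ) ^ (-((j : ℤ) - i) ^ 2) < 1 by linarith))
    refine Finset.sum_le_sum fun j _ => ?_
    rw [abs_mul, abs_of_pos (by positivity : (0 : ℝ) < 4 ^ (-((j : ℤ) - i) ^ 2))]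
    exact mul_le_of_le_one_left (by positivity) (habs _)
  rw [heval, sign_mul, sign_pos (by positivity), one_mul]
  obtain ⟨h1, h2⟩ := abs_lt.1 hSlt
  generalize b i = x at hi
  cases x with
  | zero => exact absurd rfl hi
  | pos => exact sign_pos (by simp; linarith)
  | neg => exact sign_neg (by simp; linarith)

open Polynomial in
/-- Coefficients `± 4 ^ (-i ^ 2)` or `0` attain the bound in Descartes' rule of signs. -/
theorem exists_pos_roots_of_gaussWeight {b : ℕ → SignType} {f : ℝ[X]}
    (hf : ∀ i, f.coeff i = b i * gaussWeight i) {k : ℕ} (h : HasAlternation b k) :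
    ∃ Z : Finset ℝ, Z.card = k ∧ ∀ z ∈ Z, 0 < z ∧ f.eval z = 0 := by
  obtain ⟨g, h1, h2, h3⟩ := h
  have hroot : ∀ j, ∃ z, j < k → (16 : ℝ) ^ g j < z ∧ z < 16 ^ g (j + 1) ∧ f.eval z = 0 := by
    intro j
    by_cases hj : j < k
    · have hb := alternation_ne_zero h2 h3 hj.le
      have hs := sign_eval_of_gaussWeight hf hb
      have hs' := sign_eval_of_gaussWeight hf (alternation_ne_zero h2 h3 (Nat.succ_le_of_lt hj))
      rw [Nat.succ_eq_add_one, h3 j hj] at hs'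
      have hlt : (16 : ℝ) ^ g j < 16 ^ g (j + 1) := pow_lt_pow_right₀ (by norm_num) (h1 j hj)
      have hcont : ContinuousOn (fun x => f.eval x) (Set.Icc ((16 : ℝ) ^ g j) (16 ^ g (j + 1))) :=
        f.continuous.continuousOn
      generalize b (g j) = x at *
      cases x with
      | zero => exact absurd rfl hb
      | pos =>
        obtain ⟨z, hz, hz0⟩ := intermediate_value_Ioo' hlt.le hcont
          ⟨sign_eq_neg_one_iff.1 hs', sign_eq_one_iff.1 hs⟩
        exact ⟨z, fun _ => ⟨hz.1, hz.2, hz0⟩⟩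
      | neg =>
        obtain ⟨z, hz, hz0⟩ := intermediate_value_Ioo hlt.le hcont
          ⟨sign_eq_neg_one_iff.1 hs, sign_eq_one_iff.1 hs'⟩
        exact ⟨z, fun _ => ⟨hz.1, hz.2, hz0⟩⟩
    · exact ⟨0, fun h => absurd h hj⟩
  choose z hz using hroot
  have hmono : ∀ i j, i < j → j < k → z i < z j := by
    intro i j hij
    induction j, hij using Nat.le_induction with
    | base => intro hj; exact (hz i (by omega)).2.1.trans (hz _ hj).1
    | succ j hij ih =>
      intro hj
      exact (ih (by omega)).trans ((hz j (by omega)).2.1.trans (hz _ hj).1)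
  refine ⟨(Finset.range k).image z, ?_, ?_⟩
  · rw [Finset.card_image_of_injOn, Finset.card_range]
    intro i hi j hj hij
    simp only [Finset.coe_range, Set.mem_Iio] at hi hj
    rcases lt_trichotomy i j with h | h | h
    · exact absurd hij (hmono i j h hj).ne
    · exact h
    · exact absurd hij (hmono j i h hi).ne'
  · simp only [Finset.mem_image, Finset.mem_range]
    rintro _ ⟨j, hj, rfl⟩
    exact ⟨(by positivity : (0 : ℝ) < 16 ^ g j).trans (hz j hj).1, (hz j hj).2.2⟩

/-! ### Roots of polynomials over the valuation ring of Hahn series -/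

section Hensel

variable (k : Type*) [Field k]

/-- The valuation ring of the field of Hahn series. -/
def hahnIntegers : Subring (HahnSeries ℝ k) where
  carrier := {x | 0 ≤ x.orderTop}
  mul_mem' {x y} hx hy :=
    (add_nonneg (show 0 ≤ x.orderTop from hx) hy).trans HahnSeries.orderTop_add_le_mul
  one_mem' := by simp
  add_mem' {x y} hx hy :=
    (le_min (show 0 ≤ x.orderTop from hx) hy).trans HahnSeries.min_orderTop_le_orderTop_add
  zero_mem' := by simp
  neg_mem' {x} hx := by simpa using hx

variable {k}

theorem mem_hahnIntegers {x : HahnSeries ℝ k} : x ∈ hahnIntegers k ↔ 0 ≤ x.orderTop := Iff.rfl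

variable (k) in
/-- The reduction modulo the maximal ideal: the constant coefficient. -/
def hahnResidue : hahnIntegers k →+* k where
  toFun x := x.1.coeff 0
  map_zero' := by simp
  map_one' := by simp
  map_add' x y := by simp
  map_mul' x y := by
    have nonneg : ∀ (z : hahnIntegers k) (i : ℝ), z.1.coeff i ≠ 0 → 0 ≤ i := fun z i hi =>
      WithTop.coe_le_coe.1 (z.2.trans (HahnSeries.orderTop_le_of_coeff_ne_zero hi))
    rw [Subring.coe_mul, HahnSeries.coeff_mul]
    refine Finset.sum_eq_single (0, 0) (fun ij hij hne => ?_) fun h => ?_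
    · rw [Finset.mem_antidiagonal] at hij
      have h1 := nonneg x _ hij.1
      have h2 := nonneg y _ hij.2.1
      exact absurd (Prod.ext (by simp; linarith [hij.2.2]) (by simp; linarith [hij.2.2])) hne
    · by_contra hxy
      refine h (Finset.mem_antidiagonal.2 ⟨?_, ?_, by simp⟩)
      · exact left_ne_zero_of_mul hxy
      · exact right_ne_zero_of_mul hxy

theorem hahnResidue_apply (x : hahnIntegers k) : hahnResidue k x = x.1.coeff 0 := rfl

theorem hahnResidue_eq_zero {x : hahnIntegers k} : hahnResidue k x = 0 ↔ 0 < x.1.orderTop := by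
  constructor
  · intro h
    refine x.2.lt_of_ne fun h0 => ?_
    exact HahnSeries.coeff_orderTop_ne h0.symm h
  · intro h
    exact HahnSeries.coeff_eq_zero_of_lt_orderTop h

theorem isUnit_of_hahnResidue_ne_zero {x : hahnIntegers k} (h : hahnResidue k x ≠ 0) :
    IsUnit x := by
  have h0 : x.1.orderTop = 0 :=
    le_antisymm (not_lt.1 (fun h' => h (hahnResidue_eq_zero.2 h'))) x.2
  have hx : x.1 ≠ 0 := by rintro hx; simp [hx] at h0
  have hinv : (x.1⁻¹).orderTop = 0 := by
    have := HahnSeries.orderTop_mul x.1 x.1⁻¹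
    rw [mul_inv_cancel₀ hx, h0, zero_add, HahnSeries.orderTop_one] at this
    exact this.symm
  exact IsUnit.of_mul_eq_one ⟨x.1⁻¹, hinv.ge⟩ (Subtype.ext (mul_inv_cancel₀ hx))

/-- A sequence of Hahn series whose differences have orders growing at least linearly has a limit:
each coefficient is eventually constant. -/
theorem exists_hahnSeries_limit {δ : ℝ} (hδ : 0 < δ) {a : ℕ → HahnSeries ℝ k}
    (ha : ∀ n : ℕ, ((n * δ : ℝ) : WithTop ℝ) ≤ (a (n + 1) - a n).orderTop) :
    ∃ b : HahnSeries ℝ k, ∀ n : ℕ, ((n * δ : ℝ) : WithTop ℝ) ≤ (b - a n).orderTop := by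
  have hstep : ∀ (g : ℝ) (n : ℕ), g < n * δ → ∀ m, n ≤ m → (a m).coeff g = (a n).coeff g := by
    intro g n hg m hm
    induction m, hm using Nat.le_induction with
    | base => rfl
    | succ m hm ih =>
      rw [← ih, ← sub_eq_zero, ← HahnSeries.coeff_sub]
      refine HahnSeries.coeff_eq_zero_of_lt_orderTop (lt_of_lt_of_le ?_ (ha m))
      refine WithTop.coe_lt_coe.2 (hg.trans_le ?_)
      gcongr
  have hN : ∀ g : ℝ, ∃ n : ℕ, g < n * δ := fun g => by
    obtain ⟨n, hn⟩ := exists_nat_gt (g / δ)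
    exact ⟨n, (div_lt_iff₀ hδ).1 hn⟩
  choose N hN using hN
  have hcoef : ∀ (g : ℝ) (n : ℕ), g < n * δ → (a (N g)).coeff g = (a n).coeff g := by
    intro g n hg
    rcases le_total n (N g) with h | h
    · exact hstep g n hg _ h
    · exact (hstep g _ (hN g) n h).symm
  refine ⟨⟨fun g => (a (N g)).coeff g, ?_⟩, fun n => ?_⟩
  · -- Below a given exponent, the support is contained in that of one term of the sequence.
    intro f
    by_cases hex : ∃ n, 0 < n ∧ (f 0 : ℝ) ≤ f n
    · obtain ⟨n, hn, h⟩ := hex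
      exact ⟨0, n, hn, h⟩
    · push Not at hex
      have hle : ∀ n, (f n : ℝ) ≤ f 0 := fun n => by
        rcases n.eq_zero_or_pos with rfl | hn
        · exact le_rfl
        · exact (hex n hn).le
      have hf : ∀ n, (f n : ℝ) ∈ (a (N (f 0))).support := fun n => by
        rw [HahnSeries.mem_support, ← hcoef _ _ ((hle n).trans_lt (hN _))]
        exact (f n).2
      exact (a (N (f 0))).isPWO_support (fun n => ⟨f n, hf n⟩)
  · rw [HahnSeries.le_orderTop_iff_forall]
    intro g hg
    rw [HahnSeries.coeff_sub, sub_eq_zero]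
    exact hcoef g n (WithTop.coe_lt_coe.1 hg)

/-- Divisibility in the valuation ring by a power of `t ^ δ`. -/
theorem single_pow_dvd_iff {δ : ℝ} {τ : hahnIntegers k}
    (hτ : τ.1 = HahnSeries.single δ 1) (n : ℕ) (x : hahnIntegers k) :
    τ ^ n ∣ x ↔ ((n * δ : ℝ) : WithTop ℝ) ≤ x.1.orderTop := by
  have hpow : (τ ^ n).1 = HahnSeries.single (n * δ) 1 := by
    rw [Subring.coe_pow, hτ, HahnSeries.single_pow]
    simp
  constructor
  · rintro ⟨y, rfl⟩
    rw [Subring.coe_mul, HahnSeries.orderTop_mul, hpow, HahnSeries.orderTop_single one_ne_zero]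
    exact le_add_of_nonneg_right y.2
  · intro h
    have hx : x.1 = HahnSeries.single (n * δ) 1 * (HahnSeries.single (-(n * δ)) 1 * x.1) := by
      rw [← mul_assoc, HahnSeries.single_mul_single]
      simp
    refine ⟨⟨HahnSeries.single (-(n * δ)) 1 * x.1, ?_⟩, Subtype.ext (by
      rw [Subring.coe_mul, hpow]; exact hx)⟩
    rw [mem_hahnIntegers, HahnSeries.orderTop_mul, HahnSeries.orderTop_single one_ne_zero]
    generalize x.1.orderTop = w at h
    induction w using WithTop.recTopCoe with
    | top => simp
    | coe w =>
      have := WithTop.coe_le_coe.1 h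
      rw [← WithTop.coe_add, ← WithTop.coe_zero, WithTop.coe_le_coe]
      linarith

open Polynomial in
/-- Hensel's lemma: simple roots of the reduction lift to the valuation ring. The polynomial is not
assumed to be monic. -/
theorem exists_root_of_simple_root {Q : (hahnIntegers k)[X]} {z : k}
    (h0 : (Q.map (hahnResidue k)).eval z = 0)
    (h1 : (Q.map (hahnResidue k)).derivative.eval z ≠ 0) :
    ∃ y : hahnIntegers k, Q.eval y = 0 ∧ hahnResidue k y = z := by
  set a₀ : hahnIntegers k := ⟨HahnSeries.C z, by
    rw [mem_hahnIntegers, HahnSeries.zero_le_orderTop_iff, HahnSeries.order_C]⟩ with ha₀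
  have hres : hahnResidue k a₀ = z := by simp [hahnResidue_apply, ha₀]
  have hroot : hahnResidue k (Q.eval a₀) = 0 := by
    rw [← hres, eval_map_apply] at h0
    exact h0
  have hder : hahnResidue k (Q.derivative.eval a₀) ≠ 0 := by
    rw [← hres, derivative_map, eval_map_apply] at h1
    exact h1
  by_cases hQ : Q.eval a₀ = 0
  · exact ⟨a₀, hQ, hres⟩
  obtain ⟨u, hu⟩ := isUnit_of_hahnResidue_ne_zero hder
  obtain ⟨δ, hδ⟩ := WithTop.ne_top_iff_exists.1
    (HahnSeries.orderTop_ne_top.2 (fun h => hQ (Subtype.ext h)))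
  have hδ0 : 0 < δ := by
    have := hahnResidue_eq_zero.1 hroot
    rw [← hδ] at this
    exact_mod_cast this
  set τ : hahnIntegers k := ⟨HahnSeries.single δ 1, by
    rw [mem_hahnIntegers, HahnSeries.orderTop_single one_ne_zero]
    exact_mod_cast hδ0.le⟩
  have hdvd := single_pow_dvd_iff (τ := τ) rfl
  -- Newton's iteration with the slope fixed at `a₀`; the error gains a factor `τ = t ^ δ` in
  -- each step.
  let a : ℕ → hahnIntegers k := fun n =>
    Nat.rec a₀ (fun _ x => x - Q.eval x * ((u⁻¹ : (hahnIntegers k)ˣ) : hahnIntegers k)) n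
  have ha : ∀ n, a (n + 1) = a n - Q.eval (a n) * ((u⁻¹ : (hahnIntegers k)ˣ) : hahnIntegers k) :=
    fun n => rfl
  have key : ∀ n, τ ^ (n + 1) ∣ Q.eval (a n) ∧ τ ∣ a n - a₀ := by
    intro n
    induction n with
    | zero =>
      refine ⟨(hdvd 1 _).2 (by rw [Nat.cast_one, one_mul]; exact hδ.le), ?_⟩
      change τ ∣ a₀ - a₀
      simp
    | succ n ih =>
      obtain ⟨ih1, ih2⟩ := ih
      have hτ1 : τ ∣ Q.eval (a n) := (dvd_pow_self τ n.succ_ne_zero).trans ih1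
      refine ⟨?_, ?_⟩
      · obtain ⟨c, hc⟩ := Q.binomExpansion (a n)
          (-(Q.eval (a n) * ((u⁻¹ : (hahnIntegers k)ˣ) : hahnIntegers k)))
        rw [ha, sub_eq_add_neg, hc]
        have hslope : τ ∣ (u : hahnIntegers k) - Q.derivative.eval (a n) := by
          rw [hu, ← neg_sub]
          exact (ih2.trans (sub_dvd_eval_sub (a n) a₀ Q.derivative)).neg_right
        have e : Q.eval (a n) + Q.derivative.eval (a n) *
            -(Q.eval (a n) * ((u⁻¹ : (hahnIntegers k)ˣ) : hahnIntegers k)) =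
            Q.eval (a n) * ((u : hahnIntegers k) - Q.derivative.eval (a n)) *
              ((u⁻¹ : (hahnIntegers k)ˣ) : hahnIntegers k) := by
          linear_combination (-Q.eval (a n)) * u.mul_inv
        rw [e]
        refine dvd_add ?_ ?_
        · rw [pow_succ]
          exact Dvd.dvd.mul_right (mul_dvd_mul ih1 hslope) _
        · rw [neg_sq, mul_pow, sq (Q.eval (a n)), pow_succ]
          exact Dvd.dvd.mul_left (Dvd.dvd.mul_right (mul_dvd_mul ih1 hτ1) _) _
      · rw [ha, sub_right_comm]
        exact dvd_sub ih2 (Dvd.dvd.mul_right hτ1 _)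
  obtain ⟨b, hb⟩ := exists_hahnSeries_limit hδ0 (a := fun n => (a n).1) (fun n => by
    have := (hdvd n (a (n + 1) - a n)).1 (by
      rw [ha, sub_sub_cancel_left]
      exact (((pow_dvd_pow τ n.le_succ).trans (key n).1).mul_right _).neg_right)
    simpa using this)
  have hbint : b ∈ hahnIntegers k := by
    have := hb 0
    rw [Nat.cast_zero, zero_mul] at this
    have := add_mem (mem_hahnIntegers.2 this) (a 0).2
    rwa [sub_add_cancel] at this
  have hb' : ∀ n, τ ^ n ∣ (⟨b, hbint⟩ : hahnIntegers k) - a n := fun n => (hdvd n _).2 (hb n)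
  refine ⟨⟨b, hbint⟩, ?_, ?_⟩
  · by_contra hne
    have hall : ∀ n, τ ^ n ∣ Q.eval ⟨b, hbint⟩ := fun n => by
      have h1 := (hb' n).trans (sub_dvd_eval_sub _ _ Q)
      have h2 := (pow_dvd_pow τ n.le_succ).trans (key n).1
      simpa using dvd_add h1 h2
    obtain ⟨γ, hγ⟩ := WithTop.ne_top_iff_exists.1
      (HahnSeries.orderTop_ne_top.2 (fun h => hne (Subtype.ext h)))
    obtain ⟨n, hn⟩ := exists_nat_gt (γ / δ)
    have := (hdvd n _).1 (hall n)
    rw [← hγ, WithTop.coe_le_coe] at this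
    exact absurd ((div_lt_iff₀ hδ0).1 hn) this.not_gt
  · have h1 := (hdvd 1 (⟨b, hbint⟩ - a 1)).1 (hb' 1)
    have h2 := (hdvd 1 (a 1 - a₀)).1 (by simpa using (key 1).2)
    have hpos : (0 : WithTop ℝ) < ((1 : ℕ) * δ : ℝ) := by simpa using hδ0
    have h3 := hahnResidue_eq_zero.2 (hpos.trans_le h1)
    have h4 := hahnResidue_eq_zero.2 (hpos.trans_le h2)
    rw [map_sub, sub_eq_zero] at h3 h4
    rw [h3, h4, hres]

end Hensel

/-! ### Lifting polynomials from the signed tropical hyperfield to Hahn series -/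

open Polynomial in
/-- The substitution `x ↦ u x` on a factor. -/
theorem X_sub_C_dvd_comp {K : Type*} [Field K] {u u' : K} (hu : u * u' = 1) (β : K) :
    X - C (u' * β) ∣ (X - C β : K[X]).comp (C u * X) := by
  refine ⟨C u, ?_⟩
  rw [sub_comp, X_comp, C_comp, sub_mul, ← C_mul, mul_comm u', mul_assoc, mul_comm u', hu, mul_one,
    mul_comm X]

open Polynomial in
/-- Roots of nonnegative order with real constant terms reduce to roots, with multiplicity, of the
reduction. The product of the linear factors is monic, so it divides `Q` already over the valuation
ring, and the divisibility can be reduced to the residue field. -/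
theorem real_prod_dvd_of_roots {Q : (hahnIntegers ℂ)[X]} {g : ℝ[X]}
    (hg : Q.map (hahnResidue ℂ) = g.map Complex.ofRealHom) {F : Multiset (HahnSeries ℝ ℂ)}
    {c : HahnSeries ℝ ℂ → ℝ} (hF : ∀ y ∈ F, 0 ≤ y.orderTop ∧ y.coeff 0 = c y)
    (hQ : (F.map fun y => X - C y).prod ∣ Q.map (hahnIntegers ℂ).subtype) :
    ((F.map c).map fun z => X - C z).prod ∣ g := by
  classical
  let Y : HahnSeries ℝ ℂ → hahnIntegers ℂ := fun y =>
    if h : y ∈ hahnIntegers ℂ then ⟨y, h⟩ else 0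
  have hY : ∀ y ∈ F, ((Y y : hahnIntegers ℂ) : HahnSeries ℝ ℂ) = y := fun y hy => by
    simp [Y, mem_hahnIntegers.2 (hF y hy).1]
  have hdvd : (F.map fun y => X - C (Y y)).prod ∣ Q := by
    rw [← map_dvd_map (hahnIntegers ℂ).subtype Subtype.val_injective
      (monic_multiset_prod_of_monic _ _ fun y _ => monic_X_sub_C _), Polynomial.map_multiset_prod,
      Multiset.map_map]
    rw [Multiset.map_congr rfl fun y hy => show _ = X - C y by simp [hY y hy]]
    exact hQ
  have := Polynomial.map_dvd (hahnResidue ℂ) hdvd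
  rw [hg, Polynomial.map_multiset_prod, Multiset.map_map] at this
  rw [← map_dvd_map' Complex.ofRealHom, Polynomial.map_multiset_prod, Multiset.map_map,
    Multiset.map_map]
  rw [Multiset.map_congr rfl fun y hy => show _ = X - C (c y : ℂ) by
    simp [hahnResidue_apply, hY y hy, (hF y hy).2]] at this
  rw [Multiset.map_congr rfl fun y _ => show _ = X - C (c y : ℂ) by simp]
  exact this

/-- The Hahn series `s w t ^ r` for `a = (s, r)`, and `0` for `a = ∞`. -/
noncomputable def TR.toHahn (a : TR) (w : ℝ) : HahnSeries ℝ ℝ :=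
  WithZero.recZeroCoe (motive := fun _ => HahnSeries ℝ ℝ) 0
    (fun x => HahnSeries.single x.2.toAdd (((x.1 : ℤ) : ℝ) * w)) a

namespace TR

@[simp] theorem toHahn_zero (w : ℝ) : toHahn 0 w = 0 := rfl

theorem toHahn_of (s : ℤˣ) (r w : ℝ) :
    toHahn (of s r) w = HahnSeries.single r (((s : ℤ) : ℝ) * w) := rfl

theorem vR_toHahn (a : TR) {w : ℝ} (hw : 0 < w) : vR (toHahn a w) = a := by
  rcases eq_zero_or_of a with rfl | ⟨s, r, rfl⟩
  · simp [vR]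
  · have hne : ((s : ℤ) : ℝ) * w ≠ 0 := by simp [hw.ne']
    rw [toHahn_of, vR, if_neg (by simpa using hne), HahnSeries.leadingCoeff_of_single,
      HahnSeries.order_single hne]
    rcases Int.units_eq_one_or s with rfl | rfl
    · simp [hw]
    · simp [hw.le]

end TR

theorem hahnOfReal_single (r x : ℝ) :
    hahnOfReal (HahnSeries.single r x) = HahnSeries.single r (x : ℂ) :=
  HahnSeries.map_single Complex.ofRealHom.toMonoidWithZeroHom.toZeroHom

theorem vR_eq_zero {α : HahnSeries ℝ ℝ} : vR α = 0 ↔ α = 0 := by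
  unfold vR
  split_ifs with h <;> simp [h]

namespace TRPoly

open TR Polynomial

/-- The lift of `p` to Hahn series whose nonzero coefficients are the monomials
`± 4 ^ (-i ^ 2) t ^ γ` prescribed by those of `p`. -/
noncomputable def lift (p : TRPoly) : (HahnSeries ℝ ℝ)[X] :=
  ∑ i ∈ Finset.range (p.natDegree + 1), monomial i (toHahn (p i) (gaussWeight i))

theorem coeff_lift (p : TRPoly) (i : ℕ) : (lift p).coeff i = toHahn (p i) (gaussWeight i) := by
  rw [lift, finsetSum_coeff]
  simp only [coeff_monomial, Finset.sum_ite_eq', Finset.mem_range]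
  split_ifs with h
  · rfl
  · rw [apply_eq_zero_of_natDegree_lt (by omega), toHahn_zero]

variable (p : TRPoly) (s : ℤˣ) (r m : ℝ)

/-- The real polynomial with coefficients `± 4 ^ (-i ^ 2)` whose terms are those of `p(a x)`, for
`a = (s, r)`, of valuation `m`, with their signs. If `m` is the least valuation, this is the reduction
of `t ^ (-m) P(s t ^ r x)` for the lift `P` of `p`; its positive roots correspond to the
roots of `P` of valuation `r` whose leading coefficient is real of sign `s`. -/
noncomputable def initialForm : ℝ[X] :=
  ∑ i ∈ Finset.range (p.natDegree + 1),
    monomial i ((signAt m (p i * of s r ^ i) : ℝ) * gaussWeight i)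

theorem coeff_initialForm (i : ℕ) : (initialForm p s r m).coeff i =
    (signAt m (p i * of s r ^ i) : ℝ) * gaussWeight i := by
  rw [initialForm, finsetSum_coeff]
  simp only [coeff_monomial, Finset.sum_ite_eq', Finset.mem_range]
  split_ifs with h
  · rfl
  · rw [apply_eq_zero_of_natDegree_lt (by omega)]; simp

theorem sign_coeff_initialForm (i : ℕ) : SignType.sign ((initialForm p s r m).coeff i) =
    signAt m (p i * of s r ^ i) := by
  rw [coeff_initialForm, sign_mul, sign_pos (gaussWeight_pos i), mul_one]
  generalize signAt m (p i * of s r ^ i) = x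
  cases x <;> simp

/-- The polynomial `t ^ (-m) P(s t ^ r x)` for the lift `P` of `p`. -/
noncomputable def rescaledLift : (HahnSeries ℝ ℂ)[X] :=
  C (HahnSeries.single (-m) 1) *
    ((lift p).map hahnOfReal).comp (C (HahnSeries.single r ((s : ℤ) : ℂ)) * X)

variable {p s r m}

theorem exists_integral_rescaledLift (hp : IsLevel (fun i => p i * of s r ^ i) m) :
    ∃ Q : (hahnIntegers ℂ)[X], Q.map (hahnIntegers ℂ).subtype = rescaledLift p s r m ∧
      Q.map (hahnResidue ℂ) = (initialForm p s r m).map Complex.ofRealHom := by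
  have hcoeff : ∀ i, 0 ≤ ((rescaledLift p s r m).coeff i).orderTop ∧
      ((rescaledLift p s r m).coeff i).coeff 0 = ((initialForm p s r m).coeff i : ℂ) := by
    intro i
    rw [rescaledLift, coeff_C_mul, comp_C_mul_X_coeff, coeff_map, coeff_lift, coeff_initialForm]
    have hl := hp.1 i
    rcases eq_zero_or_of (p i) with h0 | ⟨s', r', h0⟩
    · simp [h0]
    · simp only [h0, of_pow, of_mul_of, val_of, WithTop.coe_le_coe] at hl ⊢
      rw [toHahn_of, hahnOfReal_single, HahnSeries.single_pow, HahnSeries.single_mul_single,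
        HahnSeries.single_mul_single, signAt_of]
      refine ⟨le_trans ?_ HahnSeries.orderTop_single_le, ?_⟩
      · rw [← WithTop.coe_zero, WithTop.coe_le_coe, nsmul_eq_mul]
        linarith
      · rw [HahnSeries.coeff_single, nsmul_eq_mul]
        by_cases hm : r' + i * r = m
        · have hsign : ∀ x : ℤˣ, ((SignType.sign (x : ℤ) : SignType) : ℝ) = ((x : ℤ) : ℝ) := by
            intro x
            rcases Int.units_eq_one_or x with rfl | rfl <;> simp
          rw [if_pos (by linarith), if_pos hm, hsign]
          push_cast
          ring
        · rw [if_neg (fun h => hm (by linarith)), if_neg hm]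
          simp
  have hlift : rescaledLift p s r m ∈ lifts (hahnIntegers ℂ).subtype := by
    rw [lifts_iff_coeff_lifts]
    exact fun i => ⟨⟨_, (hcoeff i).1⟩, rfl⟩
  obtain ⟨Q, hQ⟩ := hlift
  refine ⟨Q, hQ, ?_⟩
  ext i
  have : ((Q.coeff i : hahnIntegers ℂ) : HahnSeries ℝ ℂ) = (rescaledLift p s r m).coeff i := by
    rw [← hQ]; simp
  rw [coeff_map, coeff_map, hahnResidue_apply, this, (hcoeff i).2]
  rfl

theorem initialForm_ne_zero (hp : IsLevel (fun i => p i * of s r ^ i) m) :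
    initialForm p s r m ≠ 0 := by
  intro h
  obtain ⟨i, hi⟩ := hp.2
  have := sign_coeff_initialForm p s r m i
  rw [h, coeff_zero, sign_zero] at this
  exact signAt_ne_zero.2 hi this.symm

theorem lift_map_ne_zero (hp : IsLevel (fun i => p i * of s r ^ i) m) :
    (lift p).map hahnOfReal ≠ 0 := by
  intro h
  obtain ⟨Q, hQ, hg⟩ := exists_integral_rescaledLift hp
  rw [rescaledLift, h, zero_comp, mul_zero, Polynomial.map_eq_zero_iff Subtype.val_injective] at hQ
  rw [hQ, Polynomial.map_zero, eq_comm,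
    Polynomial.map_eq_zero_iff Complex.ofRealHom.injective] at hg
  exact initialForm_ne_zero hp hg

theorem single_mul_single_unit (s : ℤˣ) (r : ℝ) :
    (HahnSeries.single r ((s : ℤ) : ℂ) * HahnSeries.single (-r) ((s : ℤ) : ℂ) :
      HahnSeries ℝ ℂ) = 1 := by
  rw [HahnSeries.single_mul_single, add_neg_cancel, ← Int.cast_mul, ← Units.val_mul,
    Int.units_mul_self]
  simp

theorem coeff_single_mul_zero (s : ℤˣ) (r : ℝ) (β : HahnSeries ℝ ℂ) :
    (HahnSeries.single (-r) ((s : ℤ) : ℂ) * β).coeff 0 = ((s : ℤ) : ℂ) * β.coeff r := by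
  have := HahnSeries.coeff_single_mul_add (r := ((s : ℤ) : ℂ)) (x := β) (a := r) (b := -r)
  rwa [add_neg_cancel] at this

/-- The number of roots counted by `rootCount` obeys Descartes' rule of signs. -/
theorem hasAlternation_rootCount (hp : IsLevel (fun i => p i * of s r ^ i) m) :
    HasAlternation (fun i => signAt m (p i * of s r ^ i)) (rootCount (lift p) r s) := by
  classical
  obtain ⟨Q, hQ, hg⟩ := exists_integral_rescaledLift hp
  unfold rootCount
  set F := ((lift p).map hahnOfReal).roots.filter fun β =>
    β.orderTop = (r : WithTop ℝ) ∧ ∃ c : ℝ, 0 < ((s : ℤ) : ℝ) * c ∧ β.leadingCoeff = (c : ℂ) with hF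
  have hs0 : ((s : ℤ) : ℂ) ≠ 0 := by simp
  have hmem : ∀ β ∈ F, ∃ c : ℝ, 0 < c ∧
      (HahnSeries.single (-r) ((s : ℤ) : ℂ) * β).orderTop = 0 ∧
      (HahnSeries.single (-r) ((s : ℤ) : ℂ) * β).coeff 0 = c := by
    intro β hβ
    obtain ⟨ho, c, hc, hlc⟩ := (Multiset.mem_filter.1 hβ).2
    refine ⟨_, hc, ?_, ?_⟩
    · rw [HahnSeries.orderTop_mul, HahnSeries.orderTop_single hs0, ho, ← WithTop.coe_add,
        neg_add_cancel, WithTop.coe_zero]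
    · have hβ0 : β ≠ 0 := by rintro rfl; simp at ho
      have hord : β.order = r := by
        rw [← HahnSeries.order_eq_orderTop_of_ne_zero hβ0] at ho
        exact WithTop.coe_inj.1 ho
      rw [coeff_single_mul_zero, ← hord, ← HahnSeries.leadingCoeff_eq, hlc]
      push_cast
      rfl
  have hdvd : ((F.map fun β => HahnSeries.single (-r) ((s : ℤ) : ℂ) * β).map
      fun y => X - C y).prod ∣ Q.map (hahnIntegers ℂ).subtype := by
    rw [hQ, rescaledLift, Multiset.map_map]
    refine Dvd.dvd.mul_left ?_ _
    have h1 : (F.map fun β => X - C β).prod ∣ (lift p).map hahnOfReal :=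
      (Multiset.prod_X_sub_C_dvd_iff_le_roots (lift_map_ne_zero hp) _).2 (Multiset.filter_le _ _)
    obtain ⟨R, hR⟩ := h1
    rw [hR, mul_comp, multiset_prod_comp, Multiset.map_map]
    refine Dvd.dvd.mul_right ?_ _
    exact Multiset.prod_dvd_prod_of_dvd _ _ fun β _ =>
      X_sub_C_dvd_comp (single_mul_single_unit s r) β
  have hY : ∀ y ∈ F.map fun β => HahnSeries.single (-r) ((s : ℤ) : ℂ) * β,
      0 ≤ y.orderTop ∧ y.coeff 0 = ((y.coeff 0).re : ℂ) := by
    intro y hy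
    obtain ⟨β, hβ, rfl⟩ := Multiset.mem_map.1 hy
    obtain ⟨c, -, h1, h2⟩ := hmem β hβ
    exact ⟨h1.ge, by rw [h2]; simp⟩
  have key := hasAlternation_of_prod_dvd _ ?_ (initialForm_ne_zero hp)
    (real_prod_dvd_of_roots hg (c := fun y => (y.coeff 0).re) hY hdvd)
  · simpa only [sign_coeff_initialForm, Multiset.card_map] using key
  · intro z hz
    obtain ⟨y, hy, rfl⟩ := Multiset.mem_map.1 hz
    obtain ⟨β, hβ, rfl⟩ := Multiset.mem_map.1 hy
    obtain ⟨c, hc, -, h2⟩ := hmem β hβ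
    rw [h2]
    simpa using hc

/-- Simple positive roots of the initial form lift to roots counted by `rootCount`. -/
theorem card_le_rootCount (hp : IsLevel (fun i => p i * of s r ^ i) m) {Z : Finset ℝ}
    (hpos : ∀ z ∈ Z, 0 < z) (hroot : ∀ z ∈ Z, (initialForm p s r m).eval z = 0)
    (hsimple : ∀ z ∈ Z, (initialForm p s r m).derivative.eval z ≠ 0) :
    Z.card ≤ rootCount (lift p) r s := by
  classical
  obtain ⟨Q, hQ, hg⟩ := exists_integral_rescaledLift hp
  have hex : ∀ z : ℝ, ∃ y : hahnIntegers ℂ, z ∈ Z → Q.eval y = 0 ∧ hahnResidue ℂ y = z := by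
    intro z
    by_cases hz : z ∈ Z
    · obtain ⟨y, hy⟩ := exists_root_of_simple_root (Q := Q) (z := (z : ℂ))
        (by
          rw [hg, ← Complex.ofRealHom_eq_coe, eval_map_apply, hroot z hz, map_zero])
        (by
          rw [hg, ← Complex.ofRealHom_eq_coe, derivative_map, eval_map_apply]
          simpa using hsimple z hz)
      exact ⟨y, fun _ => hy⟩
    · exact ⟨0, fun h => absurd h hz⟩
  choose y hy using hex
  have hs0 : ((s : ℤ) : ℂ) ≠ 0 := by simp
  set β : ℝ → HahnSeries ℝ ℂ := fun z => HahnSeries.single r ((s : ℤ) : ℂ) * (y z).1 with hβ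
  have hres : ∀ z ∈ Z, (y z).1.coeff 0 = z := fun z hz => (hy z hz).2
  have hcoeff : ∀ z ∈ Z, (β z).coeff r = ((s : ℤ) : ℂ) * z := fun z hz => by
    have := HahnSeries.coeff_single_mul_add (r := ((s : ℤ) : ℂ)) (x := (y z).1) (a := 0) (b := r)
    rwa [zero_add, hres z hz] at this
  have hinj : Set.InjOn β Z := by
    intro z hz z' hz' h
    have h1 := hcoeff z hz
    rw [h, hcoeff z' hz'] at h1
    exact_mod_cast (mul_left_cancel₀ hs0 h1).symm
  rw [← Finset.card_image_of_injOn hinj, rootCount]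
  refine Multiset.card_le_card ((Multiset.le_iff_subset (Finset.nodup _)).2 fun b hb => ?_)
  obtain ⟨z, hz, rfl⟩ := Finset.mem_image.1 (Finset.mem_def.2 hb)
  have hz0 : (z : ℂ) ≠ 0 := by exact_mod_cast (hpos z hz).ne'
  have hyo : (y z).1.orderTop = 0 := by
    refine le_antisymm (not_lt.1 fun h => hz0 ?_) (y z).2
    rw [← (hy z hz).2]
    exact hahnResidue_eq_zero.2 h
  have ho : (β z).orderTop = r := by
    rw [hβ, HahnSeries.orderTop_mul, HahnSeries.orderTop_single hs0, hyo, add_zero]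
  have hβ0 : β z ≠ 0 := by intro h; rw [h] at ho; simp at ho
  have hord : (β z).order = r := by
    rw [← HahnSeries.order_eq_orderTop_of_ne_zero hβ0] at ho
    exact WithTop.coe_inj.1 ho
  refine Multiset.mem_filter.2 ⟨(mem_roots (lift_map_ne_zero hp)).2 ?_, ho, (s : ℤ) * z, ?_, ?_⟩
  · have h1 : (Q.map (hahnIntegers ℂ).subtype).eval ((hahnIntegers ℂ).subtype (y z)) = 0 := by
      rw [eval_map_apply, (hy z hz).1, map_zero]
    rw [hQ, rescaledLift, eval_mul, eval_C, eval_comp, eval_mul, eval_C, eval_X] at h1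
    exact (mul_eq_zero.1 h1).resolve_left (by simp)
  · have : ((s : ℤ) : ℝ) * (s : ℤ) = 1 := by
      rcases Int.units_eq_one_or s with rfl | rfl <;> simp
    rw [← mul_assoc, this, one_mul]
    exact hpos z hz
  · rw [HahnSeries.leadingCoeff_eq, hord, hcoeff z hz]
    push_cast
    rfl

theorem le_rootCount_iff (hp : IsLevel (fun i => p i * of s r ^ i) m) (k : ℕ) :
    k ≤ rootCount (lift p) r s ↔ HasAlternation (fun i => signAt m (p i * of s r ^ i)) k := by
  classical
  set b : ℕ → SignType := fun i => signAt m (p i * of s r ^ i) with hb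
  refine ⟨fun h => (hasAlternation_rootCount hp).mono h, fun h => ?_⟩
  have hbound : ∀ l, HasAlternation b l → l ≤ p.natDegree := fun l hl =>
    hl.le_of_support fun i hi => by simp [hb, apply_eq_zero_of_natDegree_lt hi]
  -- The largest number `K` of sign changes is attained by positive roots of the initial form. A
  -- multiple root among them would contradict Descartes' rule, so all of them are simple.
  set K := Nat.findGreatest (HasAlternation b) p.natDegree with hK
  have hKalt : HasAlternation b K := Nat.findGreatest_spec (hbound k h) h
  have hmax : ∀ l, HasAlternation b l → l ≤ K := fun l hl =>
    Nat.le_findGreatest (hbound l hl) hl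
  obtain ⟨Z, hZK, hZ⟩ := exists_pos_roots_of_gaussWeight (coeff_initialForm p s r m) hKalt
  have hf0 := initialForm_ne_zero hp
  have hsimple : ∀ z ∈ Z, (initialForm p s r m).derivative.eval z ≠ 0 := by
    intro z hz hder
    have hle : z ::ₘ Z.val ≤ (initialForm p s r m).roots := by
      rw [Multiset.le_iff_count]
      intro x
      rw [count_roots, Multiset.count_cons]
      have hone : Multiset.count x Z.val ≤ 1 := Multiset.nodup_iff_count_le_one.1 Z.nodup x
      by_cases hx : x = z
      · subst hx
        have := (one_lt_rootMultiplicity_iff_isRoot hf0).2 ⟨(hZ x hz).2, hder⟩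
        rw [if_pos rfl]
        omega
      · rw [if_neg hx, add_zero]
        by_cases hxZ : x ∈ Z
        · have := (rootMultiplicity_pos hf0).2 (hZ x hxZ).2
          omega
        · rw [Multiset.count_eq_zero_of_notMem (by simpa using hxZ)]
          exact Nat.zero_le _
    have halt := hasAlternation_of_prod_dvd (z ::ₘ Z.val) (by
      intro x hx
      rcases Multiset.mem_cons.1 hx with rfl | hx
      · exact (hZ x hz).1
      · exact (hZ x hx).1) hf0 ((Multiset.prod_X_sub_C_dvd_iff_le_roots hf0 _).2 hle)
    simp only [sign_coeff_initialForm, Multiset.card_cons, Finset.card_val, hZK] at halt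
    have := hmax _ halt
    omega
  have := card_le_rootCount hp (fun z hz => (hZ z hz).1) (fun z hz => (hZ z hz).2) hsimple
  exact (hmax k h).trans (hZK ▸ this)

theorem rootCount_eq_mult (hp : IsLevel (fun i => p i * of s r ^ i) m) :
    (rootCount (lift p) r s : ℕ∞) = mult (of s r) p := by
  refine ENat.eq_of_forall_natCast_le_iff fun k => ?_
  rw [le_mult_iff (of_ne_zero s r) hp, Nat.cast_le, le_rootCount_iff hp]

theorem compNeg_mul_pow (p : TRPoly) (r : ℝ) (i : ℕ) :
    p.compNeg i * of 1 r ^ i = p i * of (-1) r ^ i := by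
  have : p.compNeg i = of (-1) 0 ^ i * p i := by rw [compNeg, Finsupp.ofSupportFinite_coe]
  rw [this, mul_comm _ (p i), mul_assoc, ← mul_pow, of_mul_of]
  simp

theorem exists_isLevel_of_ne_zero (hp : ∃ i, p i ≠ 0) (s : ℤˣ) (r : ℝ) :
    ∃ m, IsLevel (fun i => p i * of s r ^ i) m :=
  exists_isLevel (N := p.natDegree)
    (fun i hi => by rw [apply_eq_zero_of_natDegree_lt hi, zero_mul])
    (hp.imp fun _ hi => mul_ne_zero hi (pow_ne_zero _ (of_ne_zero s r)))

end TRPoly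

theorem exists_coeff_ne_zero_of_isNewtonEdge {P : Polynomial (HahnSeries ℝ ℝ)} {σ : Set (ℝ × ℝ)}
    {r : ℝ} (h : IsNewtonEdge (newt P) σ r) : ∃ i, P.coeff i ≠ 0 := by
  obtain ⟨z, hz⟩ := h.2.nonempty
  rw [h.1] at hz
  obtain ⟨y, hy, -⟩ := hz.1
  obtain ⟨_, i, hi, -⟩ := convexHull_nonempty_iff.1 ⟨_, hy⟩
  exact ⟨i, hi⟩

theorem mainTheorem3 (p : TRPoly) :
    ∃ P : Polynomial (HahnSeries ℝ ℝ),
      (∀ i : ℕ, vR (P.coeff i) = p i) ∧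
      ∀ (σ : Set (ℝ × ℝ)) (r : ℝ), IsNewtonEdge (newt P) σ (-r) →
        (rootCount P r 1 : ℕ∞) = TRPoly.mult (TR.of 1 r) p ∧
        (rootCount P r (-1) : ℕ∞) = TRPoly.mult (TR.of (-1) r) p ∧
        TRPoly.mult (TR.of (-1) r) p = TRPoly.mult (TR.of 1 r) p.compNeg := by
  have hv : ∀ i, vR ((TRPoly.lift p).coeff i) = p i := fun i => by
    rw [TRPoly.coeff_lift, TR.vR_toHahn _ (gaussWeight_pos i)]
  refine ⟨TRPoly.lift p, hv, fun σ r hσ => ?_⟩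
  have hp : ∃ i, p i ≠ 0 := (exists_coeff_ne_zero_of_isNewtonEdge hσ).imp fun i hi => by
    rw [← hv i, Ne, vR_eq_zero]
    exact hi
  obtain ⟨m, hm⟩ := TRPoly.exists_isLevel_of_ne_zero hp 1 r
  obtain ⟨m', hm'⟩ := TRPoly.exists_isLevel_of_ne_zero hp (-1) r
  refine ⟨TRPoly.rootCount_eq_mult hm, TRPoly.rootCount_eq_mult hm', ?_⟩
  have hneg : TR.IsLevel (fun i => p.compNeg i * TR.of 1 r ^ i) m' := by
    simpa only [TRPoly.compNeg_mul_pow] using hm'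
  refine ENat.eq_of_forall_natCast_le_iff fun k => ?_
  rw [TRPoly.le_mult_iff (TR.of_ne_zero _ _) hm', TRPoly.le_mult_iff (TR.of_ne_zero _ _) hneg]
  simp only [TRPoly.compNeg_mul_pow]
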